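/- Let $\Omega\subset\mathbb C$ be a simply connected domain. Identify $\mathbb R^2$ with $\mathbb C$, with the Euclidean inner product $\langle\xi,\eta\rangle=\operatorname{Re}(\xi\bar\eta)$, and write $\nabla u=u_x+iu_y$, $f_z=\frac12(f_x-if_y)$, $f_{\bar z}=\frac12(f_x+if_y)$ for weak derivatives. For $K\ge 1$, say that $A:\Omega\times\mathbb C\to\mathbb C$ is strongly elliptic with constant $K+\frac1K$ if $z\mapsto A(z,\xi)$ is measurable for every $\xi$, and for all $z\in\Omega$ and $\xi_1,\xi_2\in\mathbb C$ $$|\xi_1-\xi_2|^2+|A(z,\xi_1)-A(z,\xi_2)|^2\le\Big(K+\frac1K\Big)\langle \xi_1-\xi_2,\,A(z,\xi_1)-A(z,\xi_2)\rangle,\qquad A(z,0)=0 .$$ For $0\le k<1$, say that $\mathcal H:\Omega\times\mathbb C\to\mathbb C$ is a $k$-Lipschitz field if $z\mapsto\mathcal H(z,\zeta)$ is measurable for every $\zeta$ and $|\mathcal H(z,\zeta)-\mathcal H(z,\eta)|\le k|\zeta-\eta|$ for all $z\in\Omega$, $\zeta,\eta\in\mathbb C$. (i) Let $0\le k<1$,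 let $\mathcal H$ be a $k$-Lipschitz field and let $G:\Omega\to\mathbb C$. Then there are $A$, strongly elliptic with constant $K+\frac1K$ for $K=\frac{1+k}{1-k}$, and $g\in L^2_{\rm loc}(\Omega,\mathbb C)$, such that for every $f\in W^{1,2}_{\rm loc}(\Omega,\mathbb C)$ satisfying $$f_{\bar z}=\mathcal H(z,f_z)+G\quad\text{a.e. in }\Omega,$$ the function $u=\operatorname{Re}f\in W^{1,2}_{\rm loc}(\Omega,\mathbb R)$ is a distributional solution of $\operatorname{div}A(z,\nabla u)=\operatorname{div}g$ in $\Omega$. (ii) Conversely, let $K\ge1$, let $A$ be strongly elliptic with constant $K+\frac1K$ and let $g\in L^2_{\rm loc}(\Omega,\mathbb C)$. Then there are a $k$-Lipschitz field $\mathcal H$ with $k=\frac{K-1}{K+1}$ and $\mathcal H(z,0)=0$ for all $z\in\Omega$, and $G\in L^2_{\rm loc}(\Omega,\mathbb C)$, such that for every distributional solution $u\in W^{1,2}_{\rm loc}(\Omega,\mathbb R)$ of $\operatorname{div}A(z,\nabla u)=\operatorname{div}g$ in $\Omega$ there is $v\in W^{1,2}_{\rm loc}(\Omega,\mathbb R)$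 such that $f=u+iv$ satisfies $f_{\bar z}=\mathcal H(z,f_z)+G$ a.e. in $\Omega$. (iii) The constants in (i) and (ii) correspond exactly: for $0\le k<1$ and $K\ge1$, $K=\frac{1+k}{1-k}$ if and only if $k=\frac{K-1}{K+1}$. -/

import Mathlib

open MeasureTheory Complex

/-- Test functions on `Ω`: real-valued, smooth, with compact support contained in `Ω`. -/
structure IsTestFun (Ω : Set ℂ) (φ : ℂ → ℝ) : Prop where
  smooth : ContDiff ℝ ((⊤ : ℕ∞) : WithTop ℕ∞) φ
  compactSupport : HasCompactSupport φ
  support_subset : tsupport φ ⊆ Ω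

/-- `f ∈ L²_loc(Ω)`: `f` is square integrable on every compact subset of `Ω`. -/
def MemL2loc {F : Type*} [NormedAddCommGroup F] (Ω : Set ℂ) (f : ℂ → F) : Prop :=
  ∀ C : Set ℂ, IsCompact C → C ⊆ Ω → MemLp f 2 (volume.restrict C)

/-- `f` belongs to `W^{1,2}_loc(Ω)`, with weak partial derivatives `fx`, `fy` with respect to the
real coordinates `x = re z`, `y = im z`. -/
structure HasWeakGrad {F : Type*} [NormedAddCommGroup F] [NormedSpace ℝ F]
    (Ω : Set ℂ) (f fx fy : ℂ → F) : Prop where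
  memL2loc : MemL2loc Ω f
  memL2loc_x : MemL2loc Ω fx
  memL2loc_y : MemL2loc Ω fy
  weak_x : ∀ φ : ℂ → ℝ, IsTestFun Ω φ →
    ∫ z in Ω, fderiv ℝ φ z 1 • f z = - ∫ z in Ω, φ z • fx z
  weak_y : ∀ φ : ℂ → ℝ, IsTestFun Ω φ →
    ∫ z in Ω, fderiv ℝ φ z I • f z = - ∫ z in Ω, φ z • fy z

/-- The local Sobolev space `W^{1,2}_loc(Ω, F)`. -/
def MemW12loc {F : Type*} [NormedAddCommGroup F] [NormedSpace ℝ F]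
    (Ω : Set ℂ) (f : ℂ → F) : Prop :=
  ∃ fx fy : ℂ → F, HasWeakGrad Ω f fx fy

/-- `H(z,ζ)` is Lebesgue measurable in `z ∈ Ω` and `k`-Lipschitz in `ζ`. -/
structure IsLipschitzField (Ω : Set ℂ) (k : ℝ) (H : ℂ → ℂ → ℂ) : Prop where
  measurable : ∀ ζ : ℂ, AEMeasurable (fun z => H z ζ) (volume.restrict Ω)
  lipschitz : ∀ z ∈ Ω, ∀ ζ η : ℂ, ‖H z ζ - H z η‖ ≤ k * ‖ζ - η‖

/-- The strong ellipticity condition with constant `K + 1/K`; `ℝ²` is identified with `ℂ`, whose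
real inner product is the Euclidean one. -/
structure IsStronglyElliptic (Ω : Set ℂ) (K : ℝ) (A : ℂ → ℂ → ℂ) : Prop where
  measurable : ∀ ξ : ℂ, AEMeasurable (fun z => A z ξ) (volume.restrict Ω)
  elliptic : ∀ z ∈ Ω, ∀ ξ₁ ξ₂ : ℂ,
    ‖ξ₁ - ξ₂‖ ^ 2 + ‖A z ξ₁ - A z ξ₂‖ ^ 2 ≤
      (K + 1 / K) * inner ℝ (ξ₁ - ξ₂) (A z ξ₁ - A z ξ₂)
  map_zero : ∀ z ∈ Ω, A z 0 = 0

/-- `f ∈ W^{1,2}_loc(Ω, ℂ)` solves `f_{z̄} = H(z, f_z) + G` almost everywhere in `Ω`, where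
`f_z = (f_x - i f_y) / 2` and `f_{z̄} = (f_x + i f_y) / 2`. -/
def SolvesBeltrami (Ω : Set ℂ) (H : ℂ → ℂ → ℂ) (G : ℂ → ℂ) (f : ℂ → ℂ) : Prop :=
  ∃ fx fy : ℂ → ℂ, HasWeakGrad Ω f fx fy ∧
    ∀ᵐ z ∂(volume.restrict Ω),
      (fx z + I * fy z) / 2 = H z ((fx z - I * fy z) / 2) + G z

/-- `div V = div W` in `Ω` in the sense of distributions, for locally integrable planar vector
fields `V`, `W`; note `fderiv ℝ φ z w = ⟨∇φ(z), w⟩`. -/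
structure DivEq (Ω : Set ℂ) (V W : ℂ → ℂ) : Prop where
  locInt_left : LocallyIntegrableOn V Ω
  locInt_right : LocallyIntegrableOn W Ω
  weak : ∀ φ : ℂ → ℝ, IsTestFun Ω φ →
    ∫ z in Ω, fderiv ℝ φ z (V z) = ∫ z in Ω, fderiv ℝ φ z (W z)

/-- `u ∈ W^{1,2}_loc(Ω, ℝ)` is a distributional solution of `div A(z, ∇u) = div g` in `Ω`, where
`∇u = u_x + i u_y`. -/
def SolvesLerayLions (Ω : Set ℂ) (A : ℂ → ℂ → ℂ) (g : ℂ → ℂ) (u : ℂ → ℝ) : Prop :=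
  ∃ ux uy : ℂ → ℝ, HasWeakGrad Ω u ux uy ∧
    DivEq Ω (fun z => A z ((ux z : ℂ) + I * (uy z : ℂ))) g

/-!
For `f = u + i v` one has `∇u = conj f_z + f_z̄` and `v_y - i v_x = conj f_z - f_z̄`. If
`A(z, ∇u) - g = v_y - i v_x`, then adding and subtracting shows that `conj f_z` and `f_z̄` are, up
to the inhomogeneous terms, the half-sum and the half-difference of `∇u` and `A(z, ∇u)`. Hence the
two equations are exchanged by the Cayley transform `(ξ, A ξ) ↦ ((ξ + A ξ) / 2, (ξ - A ξ) / 2)`,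
under which strong ellipticity of `A` with constant `K + 1/K` amounts to `f_z̄` being a
`(K - 1)/(K + 1)`-Lipschitz function of `conj f_z`. Both transforms invert maps `ξ ↦ r ξ + N(z, ξ)`
with `N` Lipschitz of constant less than `r`; the inverse is measurable in `z` because it is a
limit of Picard iterates.

The conjugate function `v` exists because `i(A(z, ∇u) - g)` is weakly curl-free. On a square, the
`L²` primitive of a weakly curl-free field comes by duality from a primitive operator on test
functions that is given by bounded kernels. On a simply connected domain the local primitives
differ by locally constant cocycles, and these are coboundaries: a cocycle defines a covering space,
which has a global section by lifting the identity.
-/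

open scoped ComplexConjugate ContDiff Convolution

section LineIntegral

variable {E F : Type*} [NormedAddCommGroup E] [NormedSpace ℝ E] [NormedAddCommGroup F]

theorem exists_isCompact_forall_comp_line_eq_zero {φ : E → F} (hφ : HasCompactSupport φ) {e : E}
    (he : e ≠ 0) (z₀ : E) : ∃ k : Set ℝ, IsCompact k ∧
      ∀ z ∈ Metric.ball z₀ 1, ∀ t ∉ k, φ (z - t • e) = 0 := by
  obtain ⟨L, hL⟩ := hφ.isCompact.isBounded.exists_norm_le
  refine ⟨Metric.closedBall 0 ((‖z₀‖ + 1 + L) / ‖e‖), isCompact_closedBall _ _, fun z hz t ht => ?_⟩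
  refine image_eq_zero_of_notMem_tsupport fun hmem => ht ?_
  have hz' : ‖z‖ ≤ ‖z₀‖ + 1 := by
    have := norm_le_norm_add_norm_sub' z z₀
    have := mem_ball_iff_norm.1 hz
    linarith
  rw [mem_closedBall_zero_iff, le_div_iff₀ (norm_pos_iff.2 he), ← norm_smul]
  calc ‖t • e‖ = ‖z - (z - t • e)‖ := by rw [sub_sub_cancel]
    _ ≤ ‖z‖ + ‖z - t • e‖ := norm_sub_le _ _
    _ ≤ ‖z₀‖ + 1 + L := add_le_add hz' (hL _ hmem)

theorem hasCompactSupport_comp_line {φ : E → F} (hφ : HasCompactSupport φ) {e : E} (he : e ≠ 0)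
    (z : E) : HasCompactSupport fun t : ℝ => φ (z + t • e) := by
  obtain ⟨k, hk, hk0⟩ := exists_isCompact_forall_comp_line_eq_zero hφ he z
  refine HasCompactSupport.intro hk.neg fun t ht => ?_
  simpa using hk0 z (Metric.mem_ball_self one_pos) (-t) (by simpa using ht)

theorem integrable_comp_line {φ : E → F} (hφc : Continuous φ) (hφ : HasCompactSupport φ) {e : E}
    (he : e ≠ 0) (z : E) : Integrable fun t : ℝ => φ (z + t • e) :=
  Continuous.integrable_of_hasCompactSupport (by fun_prop) (hasCompactSupport_comp_line hφ he z)

variable [NormedSpace ℝ F]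

theorem setIntegral_comp_line_eq_convolution {S : Set ℝ} (hS : MeasurableSet S) (φ : E → F)
    (e z : E) : ∫ t in S, φ (z + t • e) =
      (S.indicator (1 : ℝ → ℝ) ⋆[ContinuousLinearMap.lsmul ℝ ℝ] fun s => φ (z - s • e)) 0 := by
  rw [convolution_def, ← integral_indicator hS]
  congr with t
  by_cases ht : t ∈ S <;> simp [ht]

theorem locallyIntegrable_indicator_one {S : Set ℝ} (hS : MeasurableSet S) :
    LocallyIntegrable (S.indicator (1 : ℝ → ℝ)) :=
  (locallyIntegrable_const 1).indicator hS

theorem contDiff_setIntegral_comp_line {S : Set ℝ} (hS : MeasurableSet S) {n : ℕ∞} {φ : E → F}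
    (hφ : ContDiff ℝ n φ) (hφc : HasCompactSupport φ) {e : E} (he : e ≠ 0) :
    ContDiff ℝ n fun z => ∫ t in S, φ (z + t • e) := by
  refine contDiff_iff_contDiffAt.2 fun z₀ => ?_
  obtain ⟨k, hk, hk0⟩ := exists_isCompact_forall_comp_line_eq_zero hφc he z₀
  have hconv := contDiffOn_convolution_right_with_param (μ := volume) (n := n)
    (ContinuousLinearMap.lsmul ℝ ℝ) (g := fun z s => φ (z - s • e)) Metric.isOpen_ball hk
    (fun z t hz => hk0 z hz t) (locallyIntegrable_indicator_one hS)
    (ContDiff.contDiffOn (by dsimp [Function.HasUncurry.uncurry]; fun_prop))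
  have hcomp := (hconv.contDiffAt (x := (z₀, 0)) ((Metric.isOpen_ball.prod isOpen_univ).mem_nhds
    ⟨Metric.mem_ball_self one_pos, trivial⟩)).comp z₀
      (f := fun z => (z, (0 : ℝ))) (by fun_prop)
  simp only [setIntegral_comp_line_eq_convolution hS]
  exact hcomp

theorem hasFDerivAt_setIntegral_comp_line (S : Set ℝ) {φ : E → F} (hφ : ContDiff ℝ 1 φ)
    (hφc : HasCompactSupport φ) {e : E} (he : e ≠ 0) (z : E) :
    HasFDerivAt (fun z => ∫ t in S, φ (z + t • e)) (∫ t in S, fderiv ℝ φ (z + t • e)) z := by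
  have hφ' : Continuous (fderiv ℝ φ) := hφ.continuous_fderiv one_ne_zero
  have hφc' : HasCompactSupport (fderiv ℝ φ) := hφc.fderiv ℝ
  obtain ⟨k, hk, hk0⟩ := exists_isCompact_forall_comp_line_eq_zero hφc' he z
  obtain ⟨C, hC⟩ := hφ'.bounded_above_of_compact_support hφc'
  refine hasFDerivAt_integral_of_dominated_of_fderiv_le (F := fun w t => φ (w + t • e))
    (F' := fun w t => fderiv ℝ φ (w + t • e)) (bound := (-k).indicator fun _ => C)
    (Metric.ball_mem_nhds z one_pos)
    (.of_forall fun w => Continuous.aestronglyMeasurable (by fun_prop))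
    (integrable_comp_line hφ.continuous hφc he z).restrict
    (Continuous.aestronglyMeasurable (by fun_prop)) (.of_forall fun t w hw => ?_)
    ((integrable_indicator_iff hk.neg.measurableSet).2
      (integrableOn_const hk.neg.measure_lt_top.ne)).restrict (.of_forall fun t w _ => ?_)
  · by_cases ht : t ∈ -k
    · simpa only [Set.indicator_of_mem ht] using hC _
    · have h0 := hk0 w hw (-t) ht
      rw [neg_smul, sub_neg_eq_add] at h0
      simp [h0, Set.indicator_of_notMem ht]
  · exact (hasFDerivAt_comp_add_right (t • e)).2 (hφ.differentiable one_ne_zero _).hasFDerivAt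

theorem fderiv_setIntegral_comp_line_apply (S : Set ℝ) {φ : E → F} (hφ : ContDiff ℝ 1 φ)
    (hφc : HasCompactSupport φ) {e : E} (he : e ≠ 0) (z v : E) :
    fderiv ℝ (fun z => ∫ t in S, φ (z + t • e)) z v = ∫ t in S, fderiv ℝ φ (z + t • e) v := by
  rw [(hasFDerivAt_setIntegral_comp_line S hφ hφc he z).fderiv,
    ContinuousLinearMap.integral_apply (integrable_comp_line
      (hφ.continuous_fderiv one_ne_zero) (hφc.fderiv ℝ) he z).restrict]

theorem deriv_comp_line {φ : E → F} (hφ : Differentiable ℝ φ) (z e : E) :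
    deriv (fun t : ℝ => φ (z + t • e)) = fun t => fderiv ℝ φ (z + t • e) e := by
  funext t
  have hline : HasDerivAt (fun t : ℝ => z + t • e) e t := by
    simpa using ((hasDerivAt_id t).smul_const e).const_add z
  exact ((hφ (z + t • e)).hasFDerivAt.comp_hasDerivAt t hline).deriv

theorem integral_Ioi_fderiv_comp_line [CompleteSpace F] {φ : E → F} (hφ : ContDiff ℝ 1 φ)
    (hφc : HasCompactSupport φ) {e : E} (he : e ≠ 0) (z : E) :
    ∫ t in Set.Ioi (0 : ℝ), fderiv ℝ φ (z + t • e) e = -φ z := by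
  have h := HasCompactSupport.integral_Ioi_deriv_eq (f := fun t : ℝ => φ (z + t • e))
    (by fun_prop) (hasCompactSupport_comp_line hφc he z) 0
  simpa only [deriv_comp_line (hφ.differentiable one_ne_zero), zero_smul, add_zero] using h

theorem integral_fderiv_comp_line {φ : E → F} (hφ : ContDiff ℝ 1 φ)
    (hφc : HasCompactSupport φ) {e : E} (he : e ≠ 0) (z : E) :
    ∫ t : ℝ, fderiv ℝ φ (z + t • e) e = 0 := by
  have hline : ContDiff ℝ 1 fun t : ℝ => φ (z + t • e) := by fun_prop
  have hlc : HasCompactSupport fun t : ℝ => φ (z + t • e) := hasCompactSupport_comp_line hφc he z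
  rw [← deriv_comp_line (hφ.differentiable one_ne_zero)]
  exact integral_eq_zero_of_hasDerivAt_of_integrable
    (fun t => (hline.differentiable one_ne_zero t).hasDerivAt)
    ((hline.continuous_deriv le_rfl).integrable_of_hasCompactSupport hlc.deriv)
    (hline.continuous.integrable_of_hasCompactSupport hlc)

end LineIntegral

section KernelOperators

variable {α β : Type*} [MeasurableSpace α] [MeasurableSpace β] {μ : Measure α} {ν : Measure β}

theorem sq_integral_le_measureReal_univ_mul [IsFiniteMeasure μ] {f : α → ℝ} (hf : MemLp f 2 μ) :
    (∫ x, f x ∂μ) ^ 2 ≤ μ.real Set.univ * ∫ x, f x ^ 2 ∂μ := by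
  set M := μ.real Set.univ with hM
  set m := ∫ x, f x ∂μ with hm
  rcases measureReal_nonneg.eq_or_lt' (a := M) with h0 | hpos
  · have : μ = 0 := by simpa [hM, measureReal_eq_zero_iff] using h0
    simp [hm, this]
  have hf1 : Integrable f μ := hf.integrable one_le_two
  have hvar : ∫ x, (M * f x - m) ^ 2 ∂μ = M * (M * ∫ x, f x ^ 2 ∂μ - m ^ 2) := by
    have hexpand : ∀ x, (M * f x - m) ^ 2 = M ^ 2 * f x ^ 2 - 2 * M * m * f x + m ^ 2 :=
      fun x => by ring
    simp only [hexpand]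
    rw [integral_add (f := fun x => M ^ 2 * f x ^ 2 - 2 * M * m * f x)
        ((hf.integrable_sq.const_mul _).sub (hf1.const_mul _)) (integrable_const _),
      integral_sub (hf.integrable_sq.const_mul _) (hf1.const_mul _), integral_const_mul,
      integral_const_mul, integral_const, smul_eq_mul]
    ring
  have hnonneg : 0 ≤ M * (M * ∫ x, f x ^ 2 ∂μ - m ^ 2) :=
    hvar ▸ integral_nonneg fun x => sq_nonneg _
  linarith [nonneg_of_mul_nonneg_right hnonneg hpos]

theorem memLp_integral_kernel_mul [IsFiniteMeasure μ] [IsFiniteMeasure ν] {k : α → α → ℝ}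
    (hk : Measurable (Function.uncurry k)) {C : ℝ} (hC : ∀ x s, |k x s| ≤ C) {f : α × β → ℝ}
    (hfm : Measurable f) (hf : MemLp f 2 (μ.prod ν)) :
    MemLp (fun p => ∫ s, k p.1 s * f (s, p.2) ∂μ) 2 (μ.prod ν) := by
  have hmeas : StronglyMeasurable fun p : α × β => ∫ s, k p.1 s * f (s, p.2) ∂μ :=
    StronglyMeasurable.integral_prod_right'
      (f := fun q : (α × β) × α => k q.1.1 q.2 * f (q.2, q.1.2))
      (Measurable.stronglyMeasurable (by fun_prop))
  have hsections : ∀ᵐ p ∂μ.prod ν,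
      Integrable (fun s => f (s, p.2)) μ ∧ Integrable (fun s => f (s, p.2) ^ 2) μ :=
    Measure.quasiMeasurePreserving_snd.ae
      ((hf.integrable one_le_two).prod_left_ae.and hf.integrable_sq.prod_left_ae)
  have hdom : Integrable (fun p : α × β => C ^ 2 * (μ.real Set.univ * ∫ s, f (s, p.2) ^ 2 ∂μ))
      (μ.prod ν) :=
    ((hf.integrable_sq.integral_prod_right.const_mul _).const_mul _).comp_snd μ
  refine (memLp_two_iff_integrable_sq hmeas.aestronglyMeasurable).2
    (hdom.mono' (hmeas.measurable.pow_const 2).aestronglyMeasurable ?_)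
  filter_upwards [hsections] with p ⟨h1, h2⟩
  have habs : MemLp (fun s => |f (s, p.2)|) 2 μ := by
    rw [memLp_two_iff_integrable_sq h1.abs.aestronglyMeasurable]
    simpa only [sq_abs] using h2
  have hle : |∫ s, k p.1 s * f (s, p.2) ∂μ| ≤ C * ∫ s, |f (s, p.2)| ∂μ := by
    rw [← integral_const_mul, ← Real.norm_eq_abs]
    refine norm_integral_le_of_norm_le (h1.abs.const_mul C) (.of_forall fun s => ?_)
    rw [Real.norm_eq_abs, abs_mul]
    exact mul_le_mul_of_nonneg_right (hC _ _) (abs_nonneg _)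
  calc ‖(∫ s, k p.1 s * f (s, p.2) ∂μ) ^ 2‖
      = |∫ s, k p.1 s * f (s, p.2) ∂μ| ^ 2 := by rw [norm_pow, Real.norm_eq_abs]
    _ ≤ (C * ∫ s, |f (s, p.2)| ∂μ) ^ 2 := by gcongr
    _ = C ^ 2 * (∫ s, |f (s, p.2)| ∂μ) ^ 2 := mul_pow _ _ _
    _ ≤ C ^ 2 * (μ.real Set.univ * ∫ s, f (s, p.2) ^ 2 ∂μ) := by
      gcongr
      simpa only [sq_abs] using sq_integral_le_measureReal_univ_mul habs

theorem integral_mul_integral_kernel_mul [IsFiniteMeasure μ] [IsFiniteMeasure ν] {k : α → α → ℝ}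
    (hk : Measurable (Function.uncurry k)) {C : ℝ} (hC : ∀ x s, |k x s| ≤ C) {f φ : α × β → ℝ}
    (hfm : Measurable f) (hf : MemLp f 2 (μ.prod ν)) (hφm : Measurable φ) {M : ℝ}
    (hφ : ∀ p, |φ p| ≤ M) :
    ∫ p, f p * ∫ s, k p.1 s * φ (s, p.2) ∂μ ∂(μ.prod ν) =
      ∫ p, (∫ s, k s p.1 * f (s, p.2) ∂μ) * φ p ∂(μ.prod ν) := by
  have hφ2 : MemLp φ 2 (μ.prod ν) := .of_bound hφm.aestronglyMeasurable M (.of_forall hφ)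
  have hTφ := memLp_integral_kernel_mul hk hC hφm hφ2
  have hTf := memLp_integral_kernel_mul (k := fun x s => k s x) (by fun_prop)
    (fun x s => hC s x) hfm hf
  refine (integral_prod_symm _ (hf.integrable_mul hTφ)).trans (Eq.trans (integral_congr_ae ?_)
    (integral_prod_symm _ (hTf.integrable_mul hφ2)).symm)
  filter_upwards [(hf.integrable one_le_two).prod_left_ae] with y hy
  have hint : Integrable (fun q : α × α => f (q.1, y) * (k q.1 q.2 * φ (q.2, y))) (μ.prod μ) := by
    refine (hy.comp_fst μ).mul_bdd (c := C * M) (by fun_prop) (.of_forall fun q => ?_)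
    rw [norm_mul]
    exact mul_le_mul (hC _ _) (hφ _) (norm_nonneg _) ((abs_nonneg _).trans (hC q.1 q.2))
  calc ∫ x, f (x, y) * ∫ s, k x s * φ (s, y) ∂μ ∂μ
      = ∫ x, ∫ s, f (x, y) * (k x s * φ (s, y)) ∂μ ∂μ := by simp only [integral_const_mul]
    _ = ∫ s, ∫ x, f (x, y) * (k x s * φ (s, y)) ∂μ ∂μ := integral_integral_swap hint
    _ = ∫ s, (∫ x, k x s * f (x, y) ∂μ) * φ (s, y) ∂μ := by
      simp only [← integral_mul_const, mul_left_comm, mul_assoc]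

theorem exists_memLp_kernel_adjoint [IsFiniteMeasure μ] [IsFiniteMeasure ν] {k : α → α → ℝ}
    (hk : Measurable (Function.uncurry k)) {C : ℝ} (hC : ∀ x s, |k x s| ≤ C) {f : α × β → ℝ}
    (hf : MemLp f 2 (μ.prod ν)) :
    ∃ g, MemLp g 2 (μ.prod ν) ∧ ∀ φ : α × β → ℝ, Measurable φ → (∃ M, ∀ p, |φ p| ≤ M) →
      ∫ p, f p * ∫ s, k p.1 s * φ (s, p.2) ∂μ ∂(μ.prod ν) = ∫ p, g p * φ p ∂(μ.prod ν) := by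
  obtain ⟨f', hfm', hff'⟩ := hf.aemeasurable
  have hf' : MemLp f' 2 (μ.prod ν) := hf.ae_eq hff'
  refine ⟨_, memLp_integral_kernel_mul (k := fun x s => k s x) (by fun_prop)
    (fun x s => hC s x) hfm' hf', fun φ hφm ⟨M, hφ⟩ => ?_⟩
  rw [← integral_mul_integral_kernel_mul hk hC hfm' hf' hφm hφ]
  exact integral_congr_ae (hff'.mono fun p hp => congrArg (· * _) hp)

end KernelOperators

/-- `T` acting on test functions on `R` has a formal adjoint preserving `L²(R)`. This carries
identities between test functions over to `L²` fields by duality. -/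
def HasL2Adjoint (R : Set ℂ) (T : (ℂ → ℝ) → ℂ → ℝ) : Prop :=
  ∀ f : ℂ → ℝ, MemLp f 2 (volume.restrict R) → ∃ g : ℂ → ℝ, MemLp g 2 (volume.restrict R) ∧
    ∀ φ : ℂ → ℝ, IsTestFun R φ → ∫ z in R, f z * T φ z = ∫ z in R, g z * φ z

namespace IsTestFun

variable {Ω Ω' : Set ℂ} {φ ψ : ℂ → ℝ}

theorem of_isCompact {K : Set ℂ} (hφ : ContDiff ℝ ∞ φ) (hK : IsCompact K) (hKΩ : K ⊆ Ω)
    (h0 : ∀ z ∉ K, φ z = 0) : IsTestFun Ω φ where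
  smooth := hφ
  compactSupport := HasCompactSupport.intro hK h0
  support_subset :=
    (closure_minimal (fun z hz => not_imp_comm.1 (h0 z) hz) hK.isClosed).trans hKΩ

theorem mono (h : IsTestFun Ω φ) (hΩ : Ω ⊆ Ω') : IsTestFun Ω' φ :=
  ⟨h.smooth, h.compactSupport, h.support_subset.trans hΩ⟩

theorem contDiff_one (h : IsTestFun Ω φ) : ContDiff ℝ 1 φ := h.smooth.of_le (by simp)

theorem continuous (h : IsTestFun Ω φ) : Continuous φ := h.smooth.continuous

theorem eq_zero (h : IsTestFun Ω φ) {z : ℂ} (hz : z ∉ Ω) : φ z = 0 :=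
  image_eq_zero_of_notMem_tsupport fun hmem => hz (h.support_subset hmem)

theorem fderiv_apply (h : IsTestFun Ω φ) (v : ℂ) : IsTestFun Ω fun z => fderiv ℝ φ z v where
  smooth := (h.smooth.fderiv_right (m := ∞) (by simp)).clm_apply contDiff_const
  compactSupport := h.compactSupport.fderiv_apply (𝕜 := ℝ) v
  support_subset := (tsupport_fderiv_apply_subset ℝ v).trans h.support_subset

theorem sub (hφ : IsTestFun Ω φ) (hψ : IsTestFun Ω ψ) : IsTestFun Ω (φ - ψ) :=
  of_isCompact (hφ.smooth.sub hψ.smooth)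
    (hφ.compactSupport.isCompact.union hψ.compactSupport.isCompact)
    (Set.union_subset hφ.support_subset hψ.support_subset) fun z hz => by
      rw [Set.mem_union, not_or] at hz
      simp [image_eq_zero_of_notMem_tsupport hz.1, image_eq_zero_of_notMem_tsupport hz.2]

theorem exists_bound (h : IsTestFun Ω φ) : ∃ C, ∀ z, |φ z| ≤ C :=
  h.continuous.bounded_above_of_compact_support h.compactSupport

theorem memLp (h : IsTestFun Ω φ) (p : ENNReal) : MemLp φ p :=
  h.continuous.memLp_of_hasCompactSupport h.compactSupport

end IsTestFun

theorem HasL2Adjoint.of_kernel {α β : Type*} [MeasurableSpace α] [MeasurableSpace β]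
    {μ : Measure α} {ν : Measure β} [IsFiniteMeasure μ] [IsFiniteMeasure ν] {R : Set ℂ}
    {T : (ℂ → ℝ) → ℂ → ℝ} {e : ℂ ≃ᵐ α × β}
    (he : MeasurePreserving e (volume.restrict R) (μ.prod ν)) {k : α → α → ℝ}
    (hk : Measurable (Function.uncurry k)) {C : ℝ} (hC : ∀ x s, |k x s| ≤ C)
    (hT : ∀ φ, IsTestFun R φ → ∀ z, T φ z = ∫ s, k (e z).1 s * φ (e.symm (s, (e z).2)) ∂μ) :
    HasL2Adjoint R T := by
  intro f hf
  obtain ⟨g, hg, hadj⟩ := exists_memLp_kernel_adjoint hk hC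
    (hf.comp_measurePreserving (he.symm e))
  refine ⟨g ∘ e, hg.comp_measurePreserving he, fun φ hφ => ?_⟩
  obtain ⟨M, hM⟩ := hφ.exists_bound
  have h := hadj (φ ∘ e.symm) (hφ.continuous.measurable.comp e.symm.measurable)
    ⟨M, fun p => hM _⟩
  rw [← he.integral_comp e.measurableEmbedding, ← he.integral_comp e.measurableEmbedding] at h
  simpa only [Function.comp_apply, e.symm_apply_apply, ← hT φ hφ] using h

theorem measurePreserving_equivRealProd_restrict {U V : Set ℝ} (hU : MeasurableSet U)
    (hV : MeasurableSet V) : MeasurePreserving measurableEquivRealProd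
      (volume.restrict (U ×ℂ V)) ((volume.restrict U).prod (volume.restrict V)) := by
  rw [Measure.prod_restrict]
  exact volume_preserving_equiv_real_prod.restrict_preimage (hU.prod hV)

theorem HasL2Adjoint.of_re_kernel {U V : Set ℝ} (hU : MeasurableSet U) (hV : MeasurableSet V)
    (hUv : volume U ≠ ⊤) (hVv : volume V ≠ ⊤) {T : (ℂ → ℝ) → ℂ → ℝ} {k : ℝ → ℝ → ℝ}
    (hk : Measurable (Function.uncurry k)) {C : ℝ} (hC : ∀ x s, |k x s| ≤ C)
    (hT : ∀ φ, IsTestFun (U ×ℂ V) φ → ∀ z, T φ z = ∫ s in U, k z.re s * φ ⟨s, z.im⟩) :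
    HasL2Adjoint (U ×ℂ V) T := by
  have := Fact.mk hUv.lt_top
  have := Fact.mk hVv.lt_top
  exact .of_kernel (measurePreserving_equivRealProd_restrict hU hV) hk hC hT

theorem HasL2Adjoint.of_im_kernel {U V : Set ℝ} (hU : MeasurableSet U) (hV : MeasurableSet V)
    (hUv : volume U ≠ ⊤) (hVv : volume V ≠ ⊤) {T : (ℂ → ℝ) → ℂ → ℝ} {k : ℝ → ℝ → ℝ}
    (hk : Measurable (Function.uncurry k)) {C : ℝ} (hC : ∀ x s, |k x s| ≤ C)
    (hT : ∀ φ, IsTestFun (U ×ℂ V) φ → ∀ z, T φ z = ∫ s in V, k z.im s * φ ⟨z.re, s⟩) :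
    HasL2Adjoint (U ×ℂ V) T := by
  have := Fact.mk hUv.lt_top
  have := Fact.mk hVv.lt_top
  exact .of_kernel (e := measurableEquivRealProd.trans .prodComm)
    (Measure.measurePreserving_swap.comp (measurePreserving_equivRealProd_restrict hU hV)) hk hC hT

/-- The primitive of `φ` in the direction `e` that vanishes far away in that direction. On a
convex domain it inverts differentiation along `e` on the test functions whose integrals along all
lines of direction `e` vanish. -/
noncomputable def rayPrimitive (e : ℂ) (φ : ℂ → ℝ) (z : ℂ) : ℝ :=
  -∫ t in Set.Ioi (0 : ℝ), φ (z + t • e)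

/-- The integral of `φ` along the horizontal line through `z`, spread over this line with
density `ρ`. If `ρ` has integral one, then `φ - lineMean ρ φ` has integral zero along every
horizontal line, hence a compactly supported primitive in the direction `1`. -/
noncomputable def lineMean (ρ : ℝ → ℝ) (φ : ℂ → ℝ) (z : ℂ) : ℝ :=
  ρ z.re * ∫ t : ℝ, φ (z + t • (1 : ℂ))

theorem isCompact_convexJoin {E : Type*} [NormedAddCommGroup E] [NormedSpace ℝ E] {s t : Set E}
    (hs : IsCompact s) (ht : IsCompact t) : IsCompact (convexJoin ℝ s t) := by
  have himage : convexJoin ℝ s t = (fun p : (E × E) × ℝ => (1 - p.2) • p.1.1 + p.2 • p.1.2) ''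
      ((s ×ˢ t) ×ˢ Set.Icc (0 : ℝ) 1) := by
    ext x
    simp only [mem_convexJoin, segment_eq_image, Set.mem_image, Set.mem_prod, Prod.exists]
    grind
  rw [himage]
  exact ((hs.prod ht).prod isCompact_Icc).image (by fun_prop)

section RayPrimitive

variable {Ω : Set ℂ} {φ : ℂ → ℝ} {e : ℂ}

theorem fderiv_rayPrimitive_apply (hφ : IsTestFun Ω φ) (he : e ≠ 0) (z v : ℂ) :
    fderiv ℝ (rayPrimitive e φ) z v = rayPrimitive e (fun w => fderiv ℝ φ w v) z := by
  have h := fderiv_setIntegral_comp_line_apply (Set.Ioi 0) hφ.contDiff_one hφ.compactSupport he z v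
  rw [rayPrimitive, ← h, ← neg_apply, ← fderiv_neg]
  rfl

theorem rayPrimitive_fderiv (hφ : IsTestFun Ω φ) (he : e ≠ 0) :
    rayPrimitive e (fun w => fderiv ℝ φ w e) = φ := by
  funext z
  rw [rayPrimitive, integral_Ioi_fderiv_comp_line hφ.contDiff_one hφ.compactSupport he, neg_neg]

theorem mem_convexJoin_tsupport_of_rayPrimitive_ne_zero
    (hline : ∀ z, ∫ t : ℝ, φ (z + t • e) = 0) {z : ℂ} (hz : rayPrimitive e φ z ≠ 0) :
    z ∈ convexJoin ℝ (tsupport φ) (tsupport φ) := by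
  obtain ⟨t, ht, hφt⟩ : ∃ t : ℝ, 0 < t ∧ φ (z + t • e) ≠ 0 := by
    by_contra! h
    refine hz ?_
    rw [rayPrimitive, setIntegral_eq_zero_of_forall_eq_zero (t := Set.Ioi 0) h, neg_zero]
  obtain ⟨s, hs, hφs⟩ : ∃ s : ℝ, s ≤ 0 ∧ φ (z + s • e) ≠ 0 := by
    by_contra! h
    refine hz ?_
    rw [rayPrimitive, setIntegral_eq_integral_of_forall_compl_eq_zero (s := Set.Ioi 0)
      fun s hs => h s (not_lt.1 hs), hline, neg_zero]
  have hts : 0 < t - s := by linarith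
  refine mem_convexJoin.2 ⟨_, subset_tsupport φ hφt, _, subset_tsupport φ hφs,
    -s / (t - s), t / (t - s), div_nonneg (by linarith) hts.le, by positivity,
    by field_simp; ring, ?_⟩
  have : (t : ℂ) - s ≠ 0 := by exact_mod_cast hts.ne'
  simp only [real_smul]
  push_cast
  field_simp
  ring

theorem IsTestFun.rayPrimitive (hφ : IsTestFun Ω φ) (hΩ : Convex ℝ Ω) (he : e ≠ 0)
    (hline : ∀ z, ∫ t : ℝ, φ (z + t • e) = 0) : IsTestFun Ω (rayPrimitive e φ) :=
  .of_isCompact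
    (contDiff_setIntegral_comp_line measurableSet_Ioi hφ.smooth hφ.compactSupport he).neg
    (isCompact_convexJoin hφ.compactSupport.isCompact hφ.compactSupport.isCompact)
    (convexJoin_subset hφ.support_subset hφ.support_subset hΩ) fun z hz => by
      by_contra h
      exact hz (mem_convexJoin_tsupport_of_rayPrimitive_ne_zero hline h)

end RayPrimitive

section LineMean

variable {Ω : Set ℂ} {U V : Set ℝ} {ρ : ℝ → ℝ} {φ : ℂ → ℝ}

theorem lineMean_fderiv_one (hφ : IsTestFun Ω φ) (ρ : ℝ → ℝ) :
    lineMean ρ (fun w => fderiv ℝ φ w 1) = 0 := by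
  funext z
  rw [lineMean, integral_fderiv_comp_line hφ.contDiff_one hφ.compactSupport one_ne_zero, mul_zero,
    Pi.zero_apply]

theorem fderiv_lineMean_I (hφ : IsTestFun Ω φ) (hρ : Differentiable ℝ ρ) (z : ℂ) :
    fderiv ℝ (lineMean ρ φ) z I = lineMean ρ (fun w => fderiv ℝ φ w I) z := by
  have hρre : HasFDerivAt (fun z : ℂ => ρ z.re) (deriv ρ z.re • reCLM) z :=
    (hρ z.re).hasDerivAt.comp_hasFDerivAt z reCLM.hasFDerivAt
  have hline := hasFDerivAt_setIntegral_comp_line Set.univ hφ.contDiff_one hφ.compactSupport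
    one_ne_zero z
  have hline' := fderiv_setIntegral_comp_line_apply Set.univ hφ.contDiff_one hφ.compactSupport
    one_ne_zero z I
  rw [hline.fderiv] at hline'
  simp only [setIntegral_univ] at hline hline'
  have hmul : HasFDerivAt (lineMean ρ φ) _ z := hρre.mul hline
  rw [hmul.fderiv, lineMean, ← hline']
  simp

theorem IsTestFun.lineMean (hφ : IsTestFun (U ×ℂ V) φ) (hρ : ContDiff ℝ ∞ ρ)
    (hρc : HasCompactSupport ρ) (hρU : tsupport ρ ⊆ U) : IsTestFun (U ×ℂ V) (lineMean ρ φ) := by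
  have hint : ContDiff ℝ ∞ fun z => ∫ t : ℝ, φ (z + t • (1 : ℂ)) := by
    simpa only [setIntegral_univ] using contDiff_setIntegral_comp_line .univ hφ.smooth
      hφ.compactSupport one_ne_zero
  refine .of_isCompact ((hρ.comp reCLM.contDiff).mul hint)
    (hρc.isCompact.reProdIm (hφ.compactSupport.isCompact.image continuous_im))
    (fun z hz => ⟨hρU hz.1, ?_⟩) fun z hz => ?_
  · obtain ⟨w, hw, hwz⟩ := hz.2
    rw [Set.mem_preimage, ← hwz]
    exact (hφ.support_subset hw).2
  · by_cases hre : z.re ∈ tsupport ρ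
    · have hφ0 : ∀ t : ℝ, φ (z + t • (1 : ℂ)) = 0 := fun t =>
        image_eq_zero_of_notMem_tsupport fun hmem => hz ⟨hre, _, hmem, by simp⟩
      rw [_root_.lineMean, integral_congr_ae (.of_forall hφ0), integral_zero, mul_zero]
    · rw [_root_.lineMean, image_eq_zero_of_notMem_tsupport hre, zero_mul]

theorem integral_sub_lineMean_comp_line (hφ : IsTestFun Ω φ) (hρ : Continuous ρ)
    (hρc : HasCompactSupport ρ) (hρ1 : ∫ t, ρ t = 1) (z : ℂ) :
    ∫ t : ℝ, (φ - lineMean ρ φ) (z + t • (1 : ℂ)) = 0 := by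
  have hmean : ∀ t : ℝ, lineMean ρ φ (z + t • (1 : ℂ)) =
      ρ (z.re + t) * ∫ s : ℝ, φ (z + s • (1 : ℂ)) := fun t => by
    rw [lineMean, ← integral_add_left_eq_self (fun s : ℝ => φ (z + s • (1 : ℂ))) t]
    simp [add_smul, add_assoc]
  have hρint : Integrable fun t => ρ (z.re + t) :=
    (hρ.integrable_of_hasCompactSupport hρc).comp_add_left z.re
  simp only [Pi.sub_apply, hmean]
  rw [integral_sub (integrable_comp_line hφ.continuous hφ.compactSupport one_ne_zero z)
    (hρint.mul_const _), integral_mul_const, integral_add_left_eq_self ρ, hρ1, one_mul, sub_self]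

end LineMean

section KernelForms

variable {U V : Set ℝ} {φ : ℂ → ℝ}

theorem IsTestFun.setIntegral_re_section (hφ : IsTestFun (U ×ℂ V) φ) (k : ℝ → ℝ) (z : ℂ) :
    ∫ s in U, k s * φ ⟨s, z.im⟩ = ∫ t : ℝ, k (z.re + t) * φ (z + t • (1 : ℂ)) := by
  have hline : ∀ t : ℝ, z + t • (1 : ℂ) = ⟨z.re + t, z.im⟩ := fun t => by
    apply Complex.ext <;> simp
  simp only [hline]
  rw [integral_add_left_eq_self fun s => k s * φ ⟨s, z.im⟩]
  exact setIntegral_eq_integral_of_forall_compl_eq_zero fun s hs => by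
    rw [hφ.eq_zero fun hmem => hs hmem.1, mul_zero]

theorem IsTestFun.setIntegral_im_section (hφ : IsTestFun (U ×ℂ V) φ) (k : ℝ → ℝ) (z : ℂ) :
    ∫ s in V, k s * φ ⟨z.re, s⟩ = ∫ t : ℝ, k (z.im + t) * φ (z + t • I) := by
  have hline : ∀ t : ℝ, z + t • I = ⟨z.re, z.im + t⟩ := fun t => by
    apply Complex.ext <;> simp
  simp only [hline]
  rw [integral_add_left_eq_self fun s => k s * φ ⟨z.re, s⟩]
  exact setIntegral_eq_integral_of_forall_compl_eq_zero fun s hs => by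
    rw [hφ.eq_zero fun hmem => hs hmem.2, mul_zero]

theorem rayPrimitive_eq_integral_ite (e : ℂ) (φ : ℂ → ℝ) (a : ℝ) (z : ℂ) :
    rayPrimitive e φ z = ∫ t : ℝ, (if a < a + t then -1 else 0) * φ (z + t • e) := by
  rw [rayPrimitive, ← integral_neg, ← integral_indicator measurableSet_Ioi]
  congr with t
  by_cases ht : 0 < t <;> simp [ht]

theorem measurable_uncurry_ite_lt :
    Measurable (Function.uncurry fun x s : ℝ => if x < s then (-1 : ℝ) else 0) :=
  .ite (measurableSet_lt measurable_fst measurable_snd) measurable_const measurable_const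

theorem abs_ite_lt_le_one (x s : ℝ) : |if x < s then (-1 : ℝ) else 0| ≤ 1 := by
  split_ifs <;> simp

variable (hU : MeasurableSet U) (hV : MeasurableSet V) (hUv : volume U ≠ ⊤) (hVv : volume V ≠ ⊤)
include hU hV hUv hVv

theorem hasL2Adjoint_rayPrimitive_one : HasL2Adjoint (U ×ℂ V) (rayPrimitive 1) :=
  .of_re_kernel hU hV hUv hVv measurable_uncurry_ite_lt abs_ite_lt_le_one fun φ hφ z => by
    rw [hφ.setIntegral_re_section, rayPrimitive_eq_integral_ite 1 φ z.re]

theorem hasL2Adjoint_rayPrimitive_I : HasL2Adjoint (U ×ℂ V) (rayPrimitive I) :=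
  .of_im_kernel hU hV hUv hVv measurable_uncurry_ite_lt abs_ite_lt_le_one fun φ hφ z => by
    rw [hφ.setIntegral_im_section, rayPrimitive_eq_integral_ite I φ z.im]

theorem hasL2Adjoint_lineMean {ρ : ℝ → ℝ} (hρ : Continuous ρ) (hρc : HasCompactSupport ρ) :
    HasL2Adjoint (U ×ℂ V) (lineMean ρ) := by
  obtain ⟨C, hC⟩ := hρ.bounded_above_of_compact_support hρc
  refine .of_re_kernel hU hV hUv hVv (k := fun x _ => ρ x) (hρ.measurable.comp measurable_fst)
    (fun x _ => hC x) fun φ hφ z => ?_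
  rw [hφ.setIntegral_re_section, integral_const_mul, lineMean]

end KernelForms

theorem exists_contDiff_tsupport_subset_integral_eq_one {U : Set ℝ} (hU : IsOpen U)
    (hne : U.Nonempty) : ∃ ρ : ℝ → ℝ, ContDiff ℝ ∞ ρ ∧ HasCompactSupport ρ ∧ tsupport ρ ⊆ U ∧
      ∫ t, ρ t = 1 := by
  obtain ⟨x, hx⟩ := hne
  obtain ⟨ε, hε, hεU⟩ := Metric.nhds_basis_closedBall.mem_iff.1 (hU.mem_nhds hx)
  let η : ContDiffBump x := ⟨ε / 2, ε, half_pos hε, half_lt_self hε⟩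
  exact ⟨η.normed volume, η.contDiff_normed, η.hasCompactSupport_normed,
    η.tsupport_normed_eq.trans_subset hεU, η.integral_normed⟩

theorem IsTestFun.integrable_mul {R Ω : Set ℂ} {f φ : ℂ → ℝ}
    (hf : MemLp f 2 (volume.restrict R)) (hφ : IsTestFun Ω φ) :
    IntegrableOn (fun z => f z * φ z) R :=
  hf.integrable_mul ((hφ.memLp 2).restrict R)

theorem exists_memLp_integral_mul_eq_rayPrimitive {U V : Set ℝ} (hU : MeasurableSet U)
    (hUv : volume U ≠ ⊤) (hV : MeasurableSet V) (hVv : volume V ≠ ⊤) {ρ : ℝ → ℝ}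
    (hρ : ContDiff ℝ ∞ ρ) (hρc : HasCompactSupport ρ) (hρU : tsupport ρ ⊆ U) {P Q : ℂ → ℝ}
    (hP : MemLp P 2 (volume.restrict (U ×ℂ V))) (hQ : MemLp Q 2 (volume.restrict (U ×ℂ V))) :
    ∃ v, MemLp v 2 (volume.restrict (U ×ℂ V)) ∧ ∀ φ, IsTestFun (U ×ℂ V) φ →
      ∫ z in U ×ℂ V, v z * φ z =
        -(∫ z in U ×ℂ V, P z * rayPrimitive 1 (φ - lineMean ρ φ) z) -
          ∫ z in U ×ℂ V, Q z * rayPrimitive I (lineMean ρ φ) z := by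
  have hmean := hasL2Adjoint_lineMean hU hV hUv hVv hρ.continuous hρc
  obtain ⟨p, hp, hpP⟩ := hasL2Adjoint_rayPrimitive_one hU hV hUv hVv P hP
  obtain ⟨q, hq, hqQ⟩ := hasL2Adjoint_rayPrimitive_I hU hV hUv hVv Q hQ
  obtain ⟨r, hr, hrpq⟩ := hmean (p - q) (hp.sub hq)
  refine ⟨r - p, hr.sub hp, fun φ hφ => ?_⟩
  have hM := hφ.lineMean hρ hρc hρU
  rw [hpP _ (hφ.sub hM), hqQ _ hM]
  have hr' := hrpq φ hφ
  simp only [Pi.sub_apply, sub_mul, mul_sub] at hr' ⊢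
  rw [integral_sub (hM.integrable_mul hp) (hM.integrable_mul hq)] at hr'
  rw [integral_sub (hφ.integrable_mul hr) (hφ.integrable_mul hp),
    integral_sub (hφ.integrable_mul hp) (hM.integrable_mul hp), ← hr']
  ring

theorem convex_reProdIm {U V : Set ℝ} (hU : Convex ℝ U) (hV : Convex ℝ V) : Convex ℝ (U ×ℂ V) :=
  (hU.linear_preimage reLm).inter (hV.linear_preimage imLm)

/-- The real fields `P`, `Q` on `Ω` satisfy `∂P/∂y = ∂Q/∂x` in the sense of distributions, the
necessary condition for `(P, Q)` to be a weak gradient. -/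
def IsWeaklyCurlFree (Ω : Set ℂ) (P Q : ℂ → ℝ) : Prop :=
  ∀ φ, IsTestFun Ω φ → ∫ z in Ω, P z * fderiv ℝ φ z I = ∫ z in Ω, Q z * fderiv ℝ φ z 1

theorem IsWeaklyCurlFree.exists_memLp_weak_primitive {U V : Set ℝ} (hU : IsOpen U)
    (hUc : Convex ℝ U) (hUn : U.Nonempty) (hUv : volume U ≠ ⊤) (hV : MeasurableSet V)
    (hVc : Convex ℝ V) (hVv : volume V ≠ ⊤) {P Q : ℂ → ℝ} (h : IsWeaklyCurlFree (U ×ℂ V) P Q)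
    (hP : MemLp P 2 (volume.restrict (U ×ℂ V))) (hQ : MemLp Q 2 (volume.restrict (U ×ℂ V))) :
    ∃ v, MemLp v 2 (volume.restrict (U ×ℂ V)) ∧ ∀ φ, IsTestFun (U ×ℂ V) φ →
      ∫ z in U ×ℂ V, v z * fderiv ℝ φ z 1 = -∫ z in U ×ℂ V, P z * φ z ∧
      ∫ z in U ×ℂ V, v z * fderiv ℝ φ z I = -∫ z in U ×ℂ V, Q z * φ z := by
  obtain ⟨ρ, hρ, hρc, hρU, hρ1⟩ := exists_contDiff_tsupport_subset_integral_eq_one hU hUn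
  obtain ⟨v, hv, hvPQ⟩ := exists_memLp_integral_mul_eq_rayPrimitive hU.measurableSet hUv hV hVv
    hρ hρc hρU hP hQ
  refine ⟨v, hv, fun φ hφ => ⟨?_, ?_⟩⟩
  · have hmean : lineMean ρ (fun w => fderiv ℝ φ w 1) = 0 := lineMean_fderiv_one hφ ρ
    rw [hvPQ _ (hφ.fderiv_apply 1), hmean, sub_zero, rayPrimitive_fderiv hφ one_ne_zero]
    simp [rayPrimitive]
  · have hM := hφ.lineMean hρ hρc hρU
    have hζ := (hφ.sub hM).rayPrimitive (convex_reProdIm hUc hVc) one_ne_zero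
      (integral_sub_lineMean_comp_line hφ hρ.continuous hρc hρ1)
    have hmean : lineMean ρ (fun w => fderiv ℝ φ w I) = fun w => fderiv ℝ (lineMean ρ φ) w I :=
      funext fun z => (fderiv_lineMean_I hφ (hρ.differentiable (by simp)) z).symm
    have hdiff : (fun w => fderiv ℝ φ w I) - (fun w => fderiv ℝ (lineMean ρ φ) w I) =
        fun w => fderiv ℝ (φ - lineMean ρ φ) w I := by
      funext w
      rw [fderiv_sub (hφ.contDiff_one.differentiable one_ne_zero w)
        (hM.contDiff_one.differentiable one_ne_zero w)]
      rfl
    rw [hvPQ _ (hφ.fderiv_apply I), hmean, hdiff, rayPrimitive_fderiv hM I_ne_zero]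
    simp only [← fderiv_rayPrimitive_apply (hφ.sub hM) one_ne_zero]
    rw [h _ hζ]
    simp only [fderiv_rayPrimitive_apply (hφ.sub hM) one_ne_zero,
      rayPrimitive_fderiv (hφ.sub hM) one_ne_zero, Pi.sub_apply, mul_sub]
    rw [integral_sub (hφ.integrable_mul hQ) (hM.integrable_mul hQ)]
    ring

namespace MemL2loc

variable {E F : Type*} [NormedAddCommGroup E] [NormedAddCommGroup F] {Ω Ω' : Set ℂ} {f g : ℂ → F}

theorem mono (h : MemL2loc Ω f) (hΩ : Ω' ⊆ Ω) : MemL2loc Ω' f :=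
  fun C hC hCΩ => h C hC (hCΩ.trans hΩ)

theorem const (Ω : Set ℂ) (c : F) : MemL2loc Ω fun _ => c := fun C hC _ => by
  have : Fact (volume C < ⊤) := ⟨hC.measure_lt_top⟩
  exact memLp_const c

theorem add (hf : MemL2loc Ω f) (hg : MemL2loc Ω g) : MemL2loc Ω fun z => f z + g z :=
  fun C hC hCΩ => (hf C hC hCΩ).add (hg C hC hCΩ)

theorem sub (hf : MemL2loc Ω f) (hg : MemL2loc Ω g) : MemL2loc Ω fun z => f z - g z :=
  fun C hC hCΩ => (hf C hC hCΩ).sub (hg C hC hCΩ)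

theorem neg (hf : MemL2loc Ω f) : MemL2loc Ω fun z => -f z :=
  fun C hC hCΩ => (hf C hC hCΩ).neg

theorem const_mul {f : ℂ → ℂ} (hf : MemL2loc Ω f) (c : ℂ) : MemL2loc Ω fun z => c * f z :=
  fun C hC hCΩ => (hf C hC hCΩ).const_mul c

theorem div_const {f : ℂ → ℂ} (hf : MemL2loc Ω f) (c : ℂ) : MemL2loc Ω fun z => f z / c := by
  simpa only [div_eq_inv_mul] using hf.const_mul c⁻¹

theorem clm_comp [NormedSpace ℝ E] [NormedSpace ℝ F] (L : E →L[ℝ] F) {f : ℂ → E}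
    (hf : MemL2loc Ω f) : MemL2loc Ω fun z => L (f z) :=
  fun C hC hCΩ => L.comp_memLp' (hf C hC hCΩ)

theorem congr_ae (hf : MemL2loc Ω f) (h : f =ᵐ[volume.restrict Ω] g) : MemL2loc Ω g :=
  fun C hC hCΩ => (hf C hC hCΩ).ae_eq (ae_restrict_of_ae_restrict_of_subset hCΩ h)

theorem locallyIntegrableOn (h : MemL2loc Ω f) (hΩ : IsOpen Ω) : LocallyIntegrableOn f Ω :=
  (locallyIntegrableOn_iff hΩ.isLocallyClosed).2 fun C hCΩ hC => by
    have : Fact (volume C < ⊤) := ⟨hC.measure_lt_top⟩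
    exact (h C hC hCΩ).integrable one_le_two

theorem of_forall_exists_isOpen
    (h : ∀ z ∈ Ω, ∃ U, IsOpen U ∧ z ∈ U ∧ MemL2loc U f) : MemL2loc Ω f := by
  intro C hC hCΩ
  refine hC.induction_on (p := fun S => MemLp f 2 (volume.restrict S)) (by simp)
    (fun S T hST hT => hT.mono_measure (Measure.restrict_mono hST le_rfl))
    (fun S T hS hT => ⟨aestronglyMeasurable_union_iff.2 ⟨hS.1, hT.1⟩, ?_⟩) fun z hz => ?_
  · rw [eLpNorm_lt_top_iff_lintegral_rpow_enorm_lt_top (by simp) (by simp)]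
    exact (lintegral_union_le _ _ _).trans_lt (ENNReal.add_lt_top.2
      ⟨lintegral_rpow_enorm_lt_top_of_eLpNorm_lt_top (by simp) (by simp) hS.2,
        lintegral_rpow_enorm_lt_top_of_eLpNorm_lt_top (by simp) (by simp) hT.2⟩)
  · obtain ⟨U, hU, hzU, hf⟩ := h z (hCΩ hz)
    obtain ⟨V, hV, hzV, hVU⟩ := exists_compact_subset hU hzU
    exact ⟨V, mem_nhdsWithin_of_mem_nhds (mem_interior_iff_mem_nhds.1 hzV), hf V hV hVU⟩

end MemL2loc

namespace IsTestFun

variable {F : Type*} [NormedAddCommGroup F] [NormedSpace ℝ F] {Ω : Set ℂ} {φ : ℂ → ℝ}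

theorem integrable_smul (hφ : IsTestFun Ω φ) {f : ℂ → F} (hf : LocallyIntegrableOn f Ω) :
    Integrable fun z => φ z • f z := by
  have hsub : (Function.support fun z => φ z • f z) ⊆ tsupport φ := fun z hz =>
    subset_tsupport φ (left_ne_zero_of_smul hz)
  exact (integrableOn_iff_integrable_of_support_subset hsub).1
    (.continuousOn_smul (hf.integrableOn_compact_subset hφ.support_subset hφ.compactSupport)
      hφ.continuous.continuousOn hφ.compactSupport)

theorem setIntegral_smul (hφ : IsTestFun Ω φ) (f : ℂ → F) :
    ∫ z in Ω, φ z • f z = ∫ z, φ z • f z :=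
  setIntegral_eq_integral_of_forall_compl_eq_zero fun z hz => by rw [hφ.eq_zero hz, zero_smul]

theorem integrable (hφ : IsTestFun Ω φ) : Integrable φ :=
  hφ.continuous.integrable_of_hasCompactSupport hφ.compactSupport

theorem integral_fderiv_apply (hφ : IsTestFun Ω φ) (e : ℂ) : ∫ z, fderiv ℝ φ z e = 0 := by
  have h := integral_mul_fderiv_eq_neg_fderiv_mul_of_integrable (μ := volume)
    (f := fun _ : ℂ => (1 : ℝ)) (g := φ) (v := e) (by simp)
    (by simpa using (hφ.fderiv_apply e).integrable) (by simpa using hφ.integrable) (by fun_prop)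
    (fun z _ => hφ.contDiff_one.differentiable one_ne_zero z)
  simpa using h

theorem exists_eq_sum (hφ : IsTestFun Ω φ) {ι : Type*} (U : ι → Set ℂ)
    (hU : ∀ i, IsOpen (U i)) (hΩ : Ω ⊆ ⋃ i, U i) :
    ∃ (s : Finset ι) (ψ : s → ℂ → ℝ), (∀ i : s, IsTestFun (Ω ∩ U i) (ψ i)) ∧
      φ = fun z => ∑ i, ψ i z := by
  obtain ⟨s, hs⟩ := hφ.compactSupport.isCompact.elim_finite_subcover U hU
    (hφ.support_subset.trans hΩ)
  obtain ⟨p, hp⟩ := SmoothPartitionOfUnity.exists_isSubordinate (modelWithCornersSelf ℝ ℂ)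
    (isClosed_tsupport φ) (fun i : s => U i) (fun i => hU i) (by rwa [Set.iUnion_subtype])
  refine ⟨s, fun i z => p i z * φ z, fun i => ⟨?_, ?_, ?_⟩, ?_⟩
  · exact (p i).contMDiff.contDiff.mul hφ.smooth
  · exact hφ.compactSupport.mul_left
  · exact Set.subset_inter (tsupport_mul_subset_right.trans hφ.support_subset)
      (tsupport_mul_subset_left.trans (hp i))
  · funext z
    rw [← Finset.sum_mul]
    by_cases hz : z ∈ tsupport φ
    · rw [← finsum_eq_sum_of_fintype, p.sum_eq_one hz, one_mul]
    · rw [image_eq_zero_of_notMem_tsupport hz, mul_zero]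

end IsTestFun

/-- `g` is the weak derivative of `f` on `Ω` in the direction `e`; thus `HasWeakGrad Ω f fx fy`
consists of `HasWeakDeriv Ω 1 f fx`, `HasWeakDeriv Ω I f fy` and local square integrability. -/
def HasWeakDeriv {F : Type*} [NormedAddCommGroup F] [NormedSpace ℝ F]
    (Ω : Set ℂ) (e : ℂ) (f g : ℂ → F) : Prop :=
  ∀ φ, IsTestFun Ω φ → ∫ z in Ω, fderiv ℝ φ z e • f z = -∫ z in Ω, φ z • g z

namespace HasWeakDeriv

variable {E F : Type*} [NormedAddCommGroup E] [NormedSpace ℝ E] [NormedAddCommGroup F]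
  [NormedSpace ℝ F] {Ω Ω' : Set ℂ} {e : ℂ} {f f' g g' : ℂ → F}

theorem iff_integral : HasWeakDeriv Ω e f g ↔
    ∀ φ, IsTestFun Ω φ → ∫ z, fderiv ℝ φ z e • f z = -∫ z, φ z • g z :=
  forall₂_congr fun φ hφ => by rw [(hφ.fderiv_apply e).setIntegral_smul, hφ.setIntegral_smul]

theorem mono (h : HasWeakDeriv Ω e f g) (hΩ : Ω' ⊆ Ω) : HasWeakDeriv Ω' e f g :=
  iff_integral.2 fun φ hφ => iff_integral.1 h φ (hφ.mono hΩ)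

theorem const [CompleteSpace F] (Ω : Set ℂ) (e : ℂ) (c : F) :
    HasWeakDeriv Ω e (fun _ => c) fun _ => 0 :=
  iff_integral.2 fun φ hφ => by
    simp only [integral_smul_const, hφ.integral_fderiv_apply e, zero_smul, smul_zero,
      integral_zero, neg_zero]

theorem congr_ae (h : HasWeakDeriv Ω e f g) (hf : f =ᵐ[volume.restrict Ω] f') :
    HasWeakDeriv Ω e f' g := fun φ hφ => by
  rw [← h φ hφ]
  refine integral_congr_ae ?_
  filter_upwards [hf] with z hz
  rw [hz]

theorem add (hf : LocallyIntegrableOn f Ω) (hg : LocallyIntegrableOn g Ω)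
    (hf' : LocallyIntegrableOn f' Ω) (hg' : LocallyIntegrableOn g' Ω)
    (h : HasWeakDeriv Ω e f g) (h' : HasWeakDeriv Ω e f' g') :
    HasWeakDeriv Ω e (fun z => f z + f' z) fun z => g z + g' z := fun φ hφ => by
  simp only [smul_add]
  rw [integral_add ((hφ.fderiv_apply e).integrable_smul hf).integrableOn
      ((hφ.fderiv_apply e).integrable_smul hf').integrableOn,
    integral_add (hφ.integrable_smul hg).integrableOn (hφ.integrable_smul hg').integrableOn,
    h φ hφ, h' φ hφ, neg_add]

theorem clm_comp [CompleteSpace E] [CompleteSpace F] (L : E →L[ℝ] F) {f g : ℂ → E}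
    (hf : LocallyIntegrableOn f Ω) (hg : LocallyIntegrableOn g Ω) (h : HasWeakDeriv Ω e f g) :
    HasWeakDeriv Ω e (fun z => L (f z)) fun z => L (g z) := fun φ hφ => by
  simp only [← map_smul]
  rw [L.integral_comp_comm ((hφ.fderiv_apply e).integrable_smul hf).integrableOn,
    L.integral_comp_comm (hφ.integrable_smul hg).integrableOn, h φ hφ, map_neg]

theorem of_forall_exists_isOpen (hf : LocallyIntegrableOn f Ω) (hg : LocallyIntegrableOn g Ω)
    (h : ∀ z ∈ Ω, ∃ U, IsOpen U ∧ z ∈ U ∧ HasWeakDeriv U e f g) : HasWeakDeriv Ω e f g := by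
  refine iff_integral.2 fun φ hφ => ?_
  choose U hU hzU hfg using fun z : Ω => h z z.2
  obtain ⟨s, ψ, hψ, rfl⟩ := hφ.exists_eq_sum U hU
    fun z hz => Set.mem_iUnion.2 ⟨⟨z, hz⟩, hzU _⟩
  have hψΩ : ∀ i, IsTestFun Ω (ψ i) := fun i => (hψ i).mono Set.inter_subset_left
  have hd : ∀ z, fderiv ℝ (fun z => ∑ i, ψ i z) z e = ∑ i, fderiv ℝ (ψ i) z e := fun z => by
    rw [fderiv_fun_sum fun i _ => (hψ i).contDiff_one.differentiable one_ne_zero z]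
    simp
  simp only [hd, Finset.sum_smul]
  rw [integral_finsetSum _ fun i _ => ((hψΩ i).fderiv_apply e).integrable_smul hf,
    integral_finsetSum _ fun i _ => (hψΩ i).integrable_smul hg, ← Finset.sum_neg_distrib]
  exact Finset.sum_congr rfl fun i _ =>
    iff_integral.1 (hfg i) _ ((hψ i).mono Set.inter_subset_right)

end HasWeakDeriv

namespace HasWeakGrad

variable {E F : Type*} [NormedAddCommGroup E] [NormedSpace ℝ E] [NormedAddCommGroup F]
  [NormedSpace ℝ F] {Ω Ω' : Set ℂ} {f fx fy g gx gy : ℂ → F}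

theorem hasWeakDeriv_one (h : HasWeakGrad Ω f fx fy) : HasWeakDeriv Ω 1 f fx := h.weak_x

theorem hasWeakDeriv_I (h : HasWeakGrad Ω f fx fy) : HasWeakDeriv Ω I f fy := h.weak_y

theorem mono (h : HasWeakGrad Ω f fx fy) (hΩ : Ω' ⊆ Ω) : HasWeakGrad Ω' f fx fy :=
  ⟨h.memL2loc.mono hΩ, h.memL2loc_x.mono hΩ, h.memL2loc_y.mono hΩ, h.hasWeakDeriv_one.mono hΩ,
    h.hasWeakDeriv_I.mono hΩ⟩

theorem const [CompleteSpace F] (Ω : Set ℂ) (c : F) :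
    HasWeakGrad Ω (fun _ => c) (fun _ => 0) fun _ => 0 :=
  ⟨.const Ω c, .const Ω 0, .const Ω 0, HasWeakDeriv.const Ω 1 c, HasWeakDeriv.const Ω I c⟩

theorem congr_ae (h : HasWeakGrad Ω f fx fy) (hfg : f =ᵐ[volume.restrict Ω] g) :
    HasWeakGrad Ω g fx fy :=
  ⟨h.memL2loc.congr_ae hfg, h.memL2loc_x, h.memL2loc_y, h.hasWeakDeriv_one.congr_ae hfg,
    h.hasWeakDeriv_I.congr_ae hfg⟩

theorem add (hΩ : IsOpen Ω) (hf : HasWeakGrad Ω f fx fy) (hg : HasWeakGrad Ω g gx gy) :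
    HasWeakGrad Ω (fun z => f z + g z) (fun z => fx z + gx z) fun z => fy z + gy z :=
  ⟨hf.memL2loc.add hg.memL2loc, hf.memL2loc_x.add hg.memL2loc_x, hf.memL2loc_y.add hg.memL2loc_y,
    hf.hasWeakDeriv_one.add (hf.memL2loc.locallyIntegrableOn hΩ)
      (hf.memL2loc_x.locallyIntegrableOn hΩ) (hg.memL2loc.locallyIntegrableOn hΩ)
      (hg.memL2loc_x.locallyIntegrableOn hΩ) hg.hasWeakDeriv_one,
    hf.hasWeakDeriv_I.add (hf.memL2loc.locallyIntegrableOn hΩ)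
      (hf.memL2loc_y.locallyIntegrableOn hΩ) (hg.memL2loc.locallyIntegrableOn hΩ)
      (hg.memL2loc_y.locallyIntegrableOn hΩ) hg.hasWeakDeriv_I⟩

theorem clm_comp [CompleteSpace E] [CompleteSpace F] (hΩ : IsOpen Ω) (L : E →L[ℝ] F)
    {f fx fy : ℂ → E} (h : HasWeakGrad Ω f fx fy) :
    HasWeakGrad Ω (fun z => L (f z)) (fun z => L (fx z)) fun z => L (fy z) :=
  ⟨h.memL2loc.clm_comp L, h.memL2loc_x.clm_comp L, h.memL2loc_y.clm_comp L,
    h.hasWeakDeriv_one.clm_comp L (h.memL2loc.locallyIntegrableOn hΩ)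
      (h.memL2loc_x.locallyIntegrableOn hΩ),
    h.hasWeakDeriv_I.clm_comp L (h.memL2loc.locallyIntegrableOn hΩ)
      (h.memL2loc_y.locallyIntegrableOn hΩ)⟩

theorem of_forall_exists_isOpen (hΩ : IsOpen Ω)
    (h : ∀ z ∈ Ω, ∃ U, IsOpen U ∧ z ∈ U ∧ HasWeakGrad U f fx fy) : HasWeakGrad Ω f fx fy := by
  choose! U hU hzU hf using h
  have hL2 : MemL2loc Ω f :=
    .of_forall_exists_isOpen fun z hz => ⟨U z, hU z hz, hzU z hz, (hf z hz).memL2loc⟩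
  have hx : MemL2loc Ω fx :=
    .of_forall_exists_isOpen fun z hz => ⟨U z, hU z hz, hzU z hz, (hf z hz).memL2loc_x⟩
  have hy : MemL2loc Ω fy :=
    .of_forall_exists_isOpen fun z hz => ⟨U z, hU z hz, hzU z hz, (hf z hz).memL2loc_y⟩
  exact ⟨hL2, hx, hy,
    HasWeakDeriv.of_forall_exists_isOpen (hL2.locallyIntegrableOn hΩ) (hx.locallyIntegrableOn hΩ)
      fun z hz => ⟨U z, hU z hz, hzU z hz, (hf z hz).hasWeakDeriv_one⟩,
    HasWeakDeriv.of_forall_exists_isOpen (hL2.locallyIntegrableOn hΩ) (hy.locallyIntegrableOn hΩ)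
      fun z hz => ⟨U z, hU z hz, hzU z hz, (hf z hz).hasWeakDeriv_I⟩⟩

end HasWeakGrad

theorem IsWeaklyCurlFree.iff_integral {Ω : Set ℂ} {P Q : ℂ → ℝ} : IsWeaklyCurlFree Ω P Q ↔
    ∀ φ, IsTestFun Ω φ → ∫ z, fderiv ℝ φ z I * P z = ∫ z, fderiv ℝ φ z 1 * Q z :=
  forall₂_congr fun φ hφ => by
    simp only [← smul_eq_mul, ← (hφ.fderiv_apply _).setIntegral_smul]
    simp only [smul_eq_mul, mul_comm]

theorem IsWeaklyCurlFree.mono {Ω Ω' : Set ℂ} {P Q : ℂ → ℝ} (h : IsWeaklyCurlFree Ω P Q)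
    (hΩ : Ω' ⊆ Ω) : IsWeaklyCurlFree Ω' P Q :=
  iff_integral.2 fun φ hφ => iff_integral.1 h φ (hφ.mono hΩ)

theorem IsTestFun.fderiv_fderiv_apply_comm {Ω : Set ℂ} {φ : ℂ → ℝ} (hφ : IsTestFun Ω φ)
    (z v w : ℂ) :
    fderiv ℝ (fun z => fderiv ℝ φ z v) z w = fderiv ℝ (fun z => fderiv ℝ φ z w) z v := by
  have hd : DifferentiableAt ℝ (fderiv ℝ φ) z :=
    (hφ.smooth.fderiv_right (m := 1) (by norm_cast)).differentiable one_ne_zero z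
  have hsym : IsSymmSndFDerivAt ℝ φ z :=
    (hφ.smooth.of_le (m := 2) (by norm_cast)).contDiffAt.isSymmSndFDerivAt (by simp)
  rw [fderiv_clm_apply hd (by fun_prop), fderiv_clm_apply hd (by fun_prop)]
  simpa using hsym.eq w v

theorem HasWeakGrad.isWeaklyCurlFree {Ω : Set ℂ} {v vx vy : ℂ → ℝ} (h : HasWeakGrad Ω v vx vy) :
    IsWeaklyCurlFree Ω vx vy := fun φ hφ => by
  have hx := h.weak_x _ (hφ.fderiv_apply I)
  have hy := h.weak_y _ (hφ.fderiv_apply 1)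
  simp only [hφ.fderiv_fderiv_apply_comm _ I 1, smul_eq_mul] at hx hy
  simpa only [mul_comm] using neg_injective (hx.symm.trans hy)

theorem ae_restrict_of_forall_exists_isOpen {X : Type*} [TopologicalSpace X]
    [SecondCountableTopology X] [MeasurableSpace X] [OpensMeasurableSpace X] {μ : Measure X}
    {s : Set X} (hs : MeasurableSet s) {p : X → Prop}
    (h : ∀ x ∈ s, ∃ U, IsOpen U ∧ x ∈ U ∧ ∀ᵐ y ∂μ.restrict U, p y) : ∀ᵐ y ∂μ.restrict s, p y := by
  rw [ae_restrict_iff' hs]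
  refine measure_null_of_locally_null _ fun x hx => ?_
  obtain ⟨U, hU, hxU, hp⟩ := h x (Classical.not_imp.1 hx).1
  refine ⟨U ∩ {y | ¬ p y}, ?_, ?_⟩
  · filter_upwards [mem_nhdsWithin_of_mem_nhds (hU.mem_nhds hxU), self_mem_nhdsWithin] with y hyU hy
    exact ⟨hyU, (Classical.not_imp.1 hy).2⟩
  · refine measure_mono_null (fun y hy => ?_) ((ae_restrict_iff' hU.measurableSet).1 hp)
    exact Classical.not_imp.2 hy

theorem neBot_ae_restrict_of_isOpen {X : Type*} [TopologicalSpace X] [MeasurableSpace X]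
    (μ : Measure X) [μ.IsOpenPosMeasure] {U : Set X} (hU : IsOpen U) (hne : U.Nonempty) :
    (ae (μ.restrict U)).NeBot :=
  ae_neBot.2 (Measure.restrict_eq_zero.not.2 (hU.measure_ne_zero μ hne))

theorem clm_apply_eq_re_smul_add_im_smul {E : Type*} [NormedAddCommGroup E] [NormedSpace ℝ E]
    (L : ℂ →L[ℝ] E) (z : ℂ) : L z = z.re • L 1 + z.im • L I := by
  rw [← map_smul, ← map_smul, ← map_add]
  congr 1
  apply Complex.ext <;> simp

section WeakGradEqZero

variable {F : Type*} [NormedAddCommGroup F] [NormedSpace ℝ F] {U : Set ℂ}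

theorem IsTestFun.comp_const_sub {Ω : Set ℂ} {ψ : ℂ → ℝ} (hψ : IsTestFun Ω ψ) {z : ℂ}
    (hU : ∀ t ∈ Ω, z - t ∈ U) : IsTestFun U fun t => ψ (z - t) :=
  .of_isCompact (hψ.smooth.comp (contDiff_const.sub contDiff_id))
    (hψ.compactSupport.isCompact.image (continuous_const.sub continuous_id))
    (Set.image_subset_iff.2 fun t ht => hU t (hψ.support_subset ht)) fun t ht =>
      image_eq_zero_of_notMem_tsupport fun h => ht ⟨z - t, h, sub_sub_cancel z t⟩

theorem HasWeakDeriv.fderiv_convolution_apply_eq_zero {Ω : Set ℂ} {ψ : ℂ → ℝ} {e : ℂ} {f : ℂ → F}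
    (h : HasWeakDeriv U e f fun _ => 0) (hf : LocallyIntegrable f) (hψ : IsTestFun Ω ψ) {z : ℂ}
    (hU : ∀ t ∈ Ω, z - t ∈ U) :
    fderiv ℝ (ψ ⋆[ContinuousLinearMap.lsmul ℝ ℝ, volume] f) z e = 0 := by
  have hd := hψ.compactSupport.hasFDerivAt_convolution_left (ContinuousLinearMap.lsmul ℝ ℝ)
    (F := F) hψ.contDiff_one hf z
  have hint := ConvolutionExistsAt.integrable_swap <|
    (hψ.compactSupport.fderiv ℝ).convolutionExists_left
      ((ContinuousLinearMap.lsmul ℝ ℝ).precompL ℂ) (hψ.contDiff_one.continuous_fderiv one_ne_zero)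
      hf z
  have hneg : ∀ t, fderiv ℝ ψ (z - t) e = -fderiv ℝ (fun t => ψ (z - t)) t e := fun t => by
    have hcomp : HasFDerivAt (fun t => ψ (z - t)) _ t :=
      (hψ.contDiff_one.differentiable one_ne_zero (z - t)).hasFDerivAt.comp t
        ((hasFDerivAt_id t).const_sub z)
    rw [hcomp.fderiv]
    simp
  have hweak := HasWeakDeriv.iff_integral.1 h _ (hψ.comp_const_sub hU)
  simp only [smul_zero, integral_zero, neg_zero] at hweak
  rw [hd.fderiv, convolution_eq_swap, ContinuousLinearMap.integral_apply hint]
  simp [ContinuousLinearMap.precompL_apply, hneg, integral_neg, hweak]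

theorem HasWeakGrad.convolution_eq_of_mem_ball {f : ℂ → F} (hf : LocallyIntegrable f) {z₀ : ℂ}
    {r : ℝ} (h : HasWeakGrad (Metric.ball z₀ (r + r)) f (fun _ => 0) fun _ => 0)
    {ψ : ℂ → ℝ} (hψ : IsTestFun (Metric.ball 0 r) ψ) {z w : ℂ} (hz : z ∈ Metric.ball z₀ r)
    (hw : w ∈ Metric.ball z₀ r) :
    (ψ ⋆[ContinuousLinearMap.lsmul ℝ ℝ, volume] f) z =
      (ψ ⋆[ContinuousLinearMap.lsmul ℝ ℝ, volume] f) w := by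
  have hsub : ∀ x ∈ Metric.ball z₀ r, ∀ t ∈ Metric.ball (0 : ℂ) r,
      x - t ∈ Metric.ball z₀ (r + r) := fun x hx t ht => by
    rw [mem_ball_iff_norm] at *
    calc ‖x - t - z₀‖ = ‖(x - z₀) - (t - 0)‖ := by congr 1; ring
      _ ≤ ‖x - z₀‖ + ‖t - 0‖ := norm_sub_le _ _
      _ < r + r := add_lt_add hx ht
  refine Metric.isOpen_ball.is_const_of_fderiv_eq_zero (𝕜 := ℝ) (convex_ball z₀ r).isPreconnected
    (fun x _ => (hψ.compactSupport.hasFDerivAt_convolution_left (ContinuousLinearMap.lsmul ℝ ℝ)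
      (F := F) hψ.contDiff_one hf x).differentiableAt.differentiableWithinAt)
    (fun x hx => ContinuousLinearMap.ext fun w => ?_) hz hw
  rw [clm_apply_eq_re_smul_add_im_smul,
    h.hasWeakDeriv_one.fderiv_convolution_apply_eq_zero hf hψ (hsub x hx),
    h.hasWeakDeriv_I.fderiv_convolution_apply_eq_zero hf hψ (hsub x hx)]
  simp

variable [CompleteSpace F]

theorem HasWeakGrad.ae_eq_const_on_ball {f : ℂ → F} (hf : LocallyIntegrable f) {z₀ : ℂ} {r : ℝ}
    (hr : 0 < r) (h : HasWeakGrad (Metric.ball z₀ (r + r)) f (fun _ => 0) fun _ => 0) :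
    ∃ c, ∀ᵐ z ∂volume.restrict (Metric.ball z₀ r), f z = c := by
  let ψ : ℕ → ContDiffBump (0 : ℂ) := fun n =>
    ⟨r / (n + 2 : ℕ) / 2, r / (n + 2 : ℕ), by positivity, half_lt_self (by positivity)⟩
  have hψ : ∀ n, IsTestFun (Metric.ball 0 r) ((ψ n).normed volume) := fun n => by
    refine ⟨(ψ n).contDiff_normed, (ψ n).hasCompactSupport_normed, ?_⟩
    rw [(ψ n).tsupport_normed_eq]
    refine Metric.closedBall_subset_ball (div_lt_self hr ?_)
    exact_mod_cast Nat.one_lt_succ_succ n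
  have hψ0 : Filter.Tendsto (fun n => (ψ n).rOut) Filter.atTop (nhds 0) :=
    (tendsto_const_div_atTop_nhds_zero_nat r).comp (Filter.tendsto_add_atTop_nat 2)
  have hψr : ∀ᶠ n in Filter.atTop, (ψ n).rOut ≤ 2 * (ψ n).rIn :=
    .of_forall fun n => (mul_div_cancel₀ (ψ n).rOut two_ne_zero).ge
  have hlim : ∀ᵐ z ∂volume.restrict (Metric.ball z₀ r), Filter.Tendsto (fun n =>
      ((ψ n).normed volume ⋆[ContinuousLinearMap.lsmul ℝ ℝ, volume] f) z₀)
      Filter.atTop (nhds (f z)) := by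
    filter_upwards [ae_restrict_mem measurableSet_ball, ae_restrict_of_ae
      (ContDiffBump.ae_convolution_tendsto_right_of_locallyIntegrable hψ0 hψr hf)] with z hz hlim
    simpa only [h.convolution_eq_of_mem_ball hf (hψ _) hz (Metric.mem_ball_self hr)] using hlim
  have := neBot_ae_restrict_of_isOpen volume Metric.isOpen_ball
    ⟨z₀, Metric.mem_ball_self hr⟩
  obtain ⟨w, hw⟩ := hlim.exists
  exact ⟨f w, hlim.mono fun z hz => tendsto_nhds_unique hz hw⟩

theorem HasWeakGrad.exists_ae_eq_const {f : ℂ → F} (hU : IsOpen U) (hUc : IsPreconnected U)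
    (h : HasWeakGrad U f (fun _ => 0) fun _ => 0) : ∃ c, ∀ᵐ z ∂volume.restrict U, f z = c := by
  have hloc : ∀ z ∈ U, ∃ r > 0, ∃ c, ∀ᵐ w ∂volume.restrict (Metric.ball z r), f w = c := by
    intro z hz
    obtain ⟨r, hr, hrU⟩ := Metric.nhds_basis_closedBall.mem_iff.1 (hU.mem_nhds hz)
    have hind : (Metric.closedBall z r).indicator f =ᵐ[volume.restrict (Metric.closedBall z r)] f :=
      indicator_ae_eq_restrict Metric.isClosed_closedBall.measurableSet
    have hint : LocallyIntegrable ((Metric.closedBall z r).indicator f) :=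
      ((integrable_indicator_iff Metric.isClosed_closedBall.measurableSet).2
        ((h.memL2loc.locallyIntegrableOn hU).integrableOn_compact_subset hrU
          (isCompact_closedBall z r))).locallyIntegrable
    have hball : Metric.ball z (r / 2 + r / 2) ⊆ Metric.closedBall z r := by
      rw [add_halves]; exact Metric.ball_subset_closedBall
    obtain ⟨c, hc⟩ := HasWeakGrad.ae_eq_const_on_ball hint (half_pos hr)
      ((h.mono (hball.trans hrU)).congr_ae
        (ae_restrict_of_ae_restrict_of_subset hball hind.symm))
    refine ⟨r / 2, half_pos hr, c, ?_⟩
    have hhalf : Metric.ball z (r / 2) ⊆ Metric.closedBall z r :=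
      Metric.ball_subset_closedBall.trans (Metric.closedBall_subset_closedBall (half_le_self hr.le))
    filter_upwards [hc, ae_restrict_of_ae_restrict_of_subset hhalf hind] with w hw hw'
    exact hw'.symm.trans hw
  choose! r hr c hc using hloc
  rcases U.eq_empty_or_nonempty with rfl | ⟨z₀, hz₀⟩
  · exact ⟨0, by simp⟩
  refine ⟨c z₀, ae_restrict_of_forall_exists_isOpen hU.measurableSet fun z hz =>
    ⟨Metric.ball z (r z), Metric.isOpen_ball, Metric.mem_ball_self (hr z hz), ?_⟩⟩
  have hcz : c z₀ = c z := by
    refine hUc.induction₂ (fun z w => c z = c w) (fun z hz => ?_) (fun _ _ _ _ _ _ => Eq.trans)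
      (fun _ _ _ _ => Eq.symm) hz₀ hz
    filter_upwards [mem_nhdsWithin_of_mem_nhds (Metric.ball_mem_nhds z (hr z hz)),
      self_mem_nhdsWithin] with w hw hwU
    have := neBot_ae_restrict_of_isOpen volume (Metric.isOpen_ball.inter Metric.isOpen_ball)
      ⟨w, hw, Metric.mem_ball_self (hr w hwU)⟩
    obtain ⟨x, hx, hx'⟩ := ((ae_restrict_of_ae_restrict_of_subset Set.inter_subset_left
      (hc z hz)).and (ae_restrict_of_ae_restrict_of_subset Set.inter_subset_right
      (hc w hwU))).exists
    exact hx.symm.trans hx'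
  exact hcz ▸ hc z hz

end WeakGradEqZero

section Coboundary

variable {B F ι : Type*} [TopologicalSpace B] {U : ι → Set B} {c : ι → ι → F}

/-- The bundle with fibre `F` glued from the charts `U i` by the translations `v ↦ v + c i j`. If
`F` is discrete it is a covering space, whose sections exhibit the cocycle `c` as a coboundary. -/
def cocycleBundle [TopologicalSpace F] [AddGroup F] [ContinuousAdd F] (hU : ∀ i, IsOpen (U i))
    (hc : ∀ i j k, (U i ∩ U j ∩ U k).Nonempty → c i j + c j k = c i k) (idx : B → ι)
    (hidx : ∀ x, x ∈ U (idx x)) : FiberBundleCore ι B F where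
  baseSet := U
  isOpen_baseSet := hU
  indexAt := idx
  mem_baseSet_at := hidx
  coordChange i j _ v := v + c i j
  coordChange_self i x hx v := by
    rw [add_eq_left.1 (hc i i i ⟨x, ⟨hx, hx⟩, hx⟩), add_zero]
  continuousOn_coordChange _ _ := (continuous_snd.add_const _).continuousOn
  coordChange_comp i j k x hx v := by rw [add_assoc, hc i j k ⟨x, hx⟩]

theorem exists_continuousOn_forall_eq_add [SimplyConnectedSpace B] [LocallyPathConnectedSpace B]
    [TopologicalSpace F] [DiscreteTopology F] [AddGroup F] (hU : ∀ i, IsOpen (U i))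
    (hcov : ∀ x, ∃ i, x ∈ U i) (hc : ∀ i j k, (U i ∩ U j ∩ U k).Nonempty → c i j + c j k = c i k) :
    ∃ s : ι → B → F, (∀ i, ContinuousOn (s i) (U i)) ∧
      ∀ i j, ∀ x ∈ U i ∩ U j, s j x = s i x + c i j := by
  choose idx hidx using hcov
  let Z := cocycleBundle hU hc idx hidx
  have hcover : IsCoveringMap (Bundle.TotalSpace.proj : Bundle.TotalSpace F Z.Fiber → B) :=
    FiberBundle.isCoveringMap
  obtain ⟨x₀⟩ : Nonempty B := inferInstance
  obtain ⟨σ, ⟨-, hσ⟩, -⟩ := hcover.existsUnique_continuousMap_lifts (ContinuousMap.id B) x₀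
    (⟨x₀, (0 : F)⟩ : Bundle.TotalSpace F Z.Fiber) rfl
  have hproj : ∀ x, (σ x).proj = x := fun x => congrFun hσ x
  refine ⟨fun i x => (Z.localTriv i (σ x)).2, fun i => ?_, fun i j x hx => ?_⟩
  · have htriv : ContinuousOn (Z.localTriv i) (Z.localTriv i).source :=
      (Z.localTriv i).continuousOn_toFun
    refine continuous_snd.comp_continuousOn
      (htriv.comp σ.continuous.continuousOn fun x hx => ?_)
    rw [FiberBundleCore.mem_localTriv_source]
    exact (hproj x).symm ▸ hx
  · have htriv : ∀ k, (Z.localTriv k (σ x)).2 = (show F from (σ x).2) + c (idx (σ x).proj) k :=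
      fun k => rfl
    have hmem : x ∈ U (idx (σ x).proj) := (hproj x).symm ▸ hidx x
    change (Z.localTriv j (σ x)).2 = (Z.localTriv i (σ x)).2 + c i j
    rw [htriv, htriv, add_assoc, hc _ i j ⟨x, ⟨hmem, hx.1⟩, hx.2⟩]

theorem exists_coboundary [SimplyConnectedSpace B] [LocallyPathConnectedSpace B] [AddGroup F]
    (hU : ∀ i, IsOpen (U i)) (hUc : ∀ i, IsPreconnected (U i)) (hcov : ∀ x, ∃ i, x ∈ U i)
    (hc : ∀ i j k, (U i ∩ U j ∩ U k).Nonempty → c i j + c j k = c i k) :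
    ∃ d : ι → F, ∀ i j, (U i ∩ U j).Nonempty → d j = d i + c i j := by
  let _ : TopologicalSpace F := ⊥
  have _ : DiscreteTopology F := ⟨rfl⟩
  obtain ⟨s, hs, hsc⟩ := exists_continuousOn_forall_eq_add hU hcov hc
  have hconst : ∀ i, ∃ d, ∀ x ∈ U i, s i x = d := fun i => by
    rcases (U i).eq_empty_or_nonempty with hempty | ⟨y, hy⟩
    · exact ⟨0, by simp [hempty]⟩
    · exact ⟨s i y, fun x hx => (hUc i).constant (hs i) hx hy⟩
  choose d hd using hconst
  refine ⟨d, fun i j ⟨x, hx⟩ => ?_⟩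
  rw [← hd i x hx.1, ← hd j x hx.2, hsc i j x hx]

theorem exists_coboundary_of_isSimplyConnected [LocallyPathConnectedSpace B] [AddGroup F]
    {Ω : Set B} (hsc : IsSimplyConnected Ω) (hΩ : IsOpen Ω) (hU : ∀ i, IsOpen (U i))
    (hUΩ : ∀ i, U i ⊆ Ω) (hUc : ∀ i, IsPreconnected (U i)) (hcov : ∀ x ∈ Ω, ∃ i, x ∈ U i)
    (hc : ∀ i j k, (U i ∩ U j ∩ U k).Nonempty → c i j + c j k = c i k) :
    ∃ d : ι → F, ∀ i j, (U i ∩ U j).Nonempty → d j = d i + c i j := by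
  have : SimplyConnectedSpace Ω := hsc
  have : LocallyPathConnectedSpace Ω := hΩ.locallyPathConnectedSpace
  obtain ⟨d, hd⟩ := exists_coboundary (U := fun i => ((↑) : Ω → B) ⁻¹' U i)
    (fun i => (hU i).preimage continuous_subtype_val)
    (fun i => by
      rw [← Topology.IsInducing.subtypeVal.isPreconnected_image, Subtype.image_preimage_coe,
        Set.inter_eq_right.2 (hUΩ i)]
      exact hUc i)
    (fun x => hcov x x.2) (fun i j k ⟨x, hx⟩ => hc i j k ⟨x, hx⟩)
  exact ⟨d, fun i j ⟨x, hx⟩ => hd i j ⟨⟨x, hUΩ i hx.1⟩, hx⟩⟩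

end Coboundary

theorem exists_forall_ae_eq_of_forall_ae_eq_inter {X ι F : Type*} [TopologicalSpace X]
    [SecondCountableTopology X] [MeasurableSpace X] [OpensMeasurableSpace X] [Nonempty F]
    {μ : Measure X} {U : ι → Set X} (hU : ∀ i, IsOpen (U i)) {f : ι → X → F}
    (h : ∀ i j, f i =ᵐ[μ.restrict (U i ∩ U j)] f j) : ∃ g, ∀ i, g =ᵐ[μ.restrict (U i)] f i := by
  obtain ⟨T, hT, hTU⟩ := TopologicalSpace.isOpen_iUnion_countable U hU
  have hpick : ∀ x, ∃ y, ∀ i, x ∈ U i → ∃ j ∈ T, x ∈ U j ∧ y = f j x := fun x => by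
    by_cases hx : x ∈ ⋃ i ∈ T, U i
    · obtain ⟨j, hj, hxj⟩ := Set.mem_iUnion₂.1 hx
      exact ⟨f j x, fun _ _ => ⟨j, hj, hxj, rfl⟩⟩
    · exact ⟨Classical.arbitrary F, fun i hi => absurd (hTU ▸ Set.mem_iUnion_of_mem i hi) hx⟩
  choose g hg using hpick
  refine ⟨g, fun i => (ae_restrict_iff' (hU i).measurableSet).2 ?_⟩
  have hT_ae : ∀ᵐ x ∂μ, ∀ j ∈ T, x ∈ U i ∩ U j → f i x = f j x := (ae_ball_iff hT).2 fun j _ =>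
    (ae_restrict_iff' ((hU i).inter (hU j)).measurableSet).1 (h i j)
  filter_upwards [hT_ae] with x hx hxi
  obtain ⟨j, hj, hxj, hgx⟩ := hg x i hxi
  exact hgx.trans (hx j hj ⟨hxi, hxj⟩).symm

section WeakPoincare

variable {F : Type*} [NormedAddCommGroup F] [NormedSpace ℝ F] [CompleteSpace F] {Ω : Set ℂ}

theorem HasWeakGrad.exists_ae_sub_eq_const {U : Set ℂ} {v w fx fy : ℂ → F} (hU : IsOpen U)
    (hUc : IsPreconnected U) (hv : HasWeakGrad U v fx fy) (hw : HasWeakGrad U w fx fy) :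
    ∃ c, ∀ᵐ z ∂volume.restrict U, v z - w z = c := by
  refine HasWeakGrad.exists_ae_eq_const hU hUc ?_
  simpa [sub_eq_add_neg] using hv.add hU (hw.clm_comp hU (-ContinuousLinearMap.id ℝ F))

theorem HasWeakGrad.exists_of_cover (hΩ : IsOpen Ω) (hsc : IsSimplyConnected Ω) {ι : Type*}
    {U : ι → Set ℂ} (hU : ∀ i, IsOpen (U i)) (hUc : ∀ i, Convex ℝ (U i)) (hUΩ : ∀ i, U i ⊆ Ω)
    (hcov : ∀ z ∈ Ω, ∃ i, z ∈ U i) {v : ι → ℂ → F} {fx fy : ℂ → F}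
    (hv : ∀ i, HasWeakGrad (U i) (v i) fx fy) : ∃ f, HasWeakGrad Ω f fx fy := by
  have hconst : ∀ i j, ∃ c, ∀ᵐ z ∂volume.restrict (U i ∩ U j), v i z - v j z = c := fun i j =>
    HasWeakGrad.exists_ae_sub_eq_const ((hU i).inter (hU j))
      ((hUc i).inter (hUc j)).isPreconnected ((hv i).mono Set.inter_subset_left)
      ((hv j).mono Set.inter_subset_right)
  choose c hc using hconst
  have hcocycle : ∀ i j k, (U i ∩ U j ∩ U k).Nonempty → c i j + c j k = c i k := by
    intro i j k hne
    have := neBot_ae_restrict_of_isOpen volume (((hU i).inter (hU j)).inter (hU k)) hne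
    obtain ⟨z, hij, hjk, hik⟩ :=
      ((ae_restrict_of_ae_restrict_of_subset Set.inter_subset_left (hc i j)).and
      ((ae_restrict_of_ae_restrict_of_subset
        (Set.inter_subset_inter_left _ Set.inter_subset_right) (hc j k)).and
      (ae_restrict_of_ae_restrict_of_subset
        (Set.inter_subset_inter_left _ Set.inter_subset_left) (hc i k)))).exists
    rw [← hij, ← hjk, ← hik, sub_add_sub_cancel]
  obtain ⟨d, hd⟩ := exists_coboundary_of_isSimplyConnected hsc hΩ hU hUΩ
    (fun i => (hUc i).isPreconnected) hcov hcocycle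
  obtain ⟨f, hf⟩ := exists_forall_ae_eq_of_forall_ae_eq_inter (f := fun i z => v i z + d i)
    (μ := volume) hU fun i j => by
      filter_upwards [hc i j, ae_restrict_mem ((hU i).inter (hU j)).measurableSet] with z hz hzU
      rw [hd i j ⟨z, hzU⟩, ← hz]
      abel
  refine ⟨f, .of_forall_exists_isOpen hΩ fun z hz => ?_⟩
  obtain ⟨i, hi⟩ := hcov z hz
  refine ⟨U i, hU i, hi, ?_⟩
  simpa using ((hv i).add (hU i) (HasWeakGrad.const (U i) (d i))).congr_ae (hf i).symm

theorem exists_closedBall_reProdIm_subset (hΩ : IsOpen Ω) {z : ℂ} (hz : z ∈ Ω) :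
    ∃ r > 0, Metric.closedBall z.re r ×ℂ Metric.closedBall z.im r ⊆ Ω := by
  obtain ⟨ε, hε, h⟩ := Metric.isOpen_iff.1 hΩ z hz
  refine ⟨ε / 3, by positivity, fun w hw => h (mem_ball_iff_norm.2 ?_)⟩
  have hre : |(w - z).re| ≤ ε / 3 := hw.1
  have him : |(w - z).im| ≤ ε / 3 := hw.2
  linarith [norm_le_abs_re_add_abs_im (w - z)]

theorem IsWeaklyCurlFree.exists_hasWeakGrad_of_mem {P Q : ℂ → ℝ} (h : IsWeaklyCurlFree Ω P Q)
    (hΩ : IsOpen Ω) (hP : MemL2loc Ω P) (hQ : MemL2loc Ω Q) {z : ℂ} (hz : z ∈ Ω) :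
    ∃ U v, IsOpen U ∧ Convex ℝ U ∧ U ⊆ Ω ∧ z ∈ U ∧ HasWeakGrad U v P Q := by
  obtain ⟨r, hr, hrΩ⟩ := exists_closedBall_reProdIm_subset hΩ hz
  set R := Metric.ball z.re r ×ℂ Metric.ball z.im r
  have hR : R ⊆ Metric.closedBall z.re r ×ℂ Metric.closedBall z.im r := fun w hw =>
    ⟨Metric.ball_subset_closedBall hw.1, Metric.ball_subset_closedBall hw.2⟩
  have hL2 : ∀ f : ℂ → ℝ, MemL2loc Ω f → MemLp f 2 (volume.restrict R) := fun f hf =>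
    (hf _ ((isCompact_closedBall _ _).reProdIm (isCompact_closedBall _ _)) hrΩ).mono_measure
      (Measure.restrict_mono hR le_rfl)
  have hloc : ∀ f : ℂ → ℝ, MemLp f 2 (volume.restrict R) → MemL2loc R f := fun f hf C _ hC =>
    hf.mono_measure (Measure.restrict_mono hC le_rfl)
  obtain ⟨v, hv, hvPQ⟩ := (h.mono (hR.trans hrΩ)).exists_memLp_weak_primitive Metric.isOpen_ball
    (convex_ball _ _) (Metric.nonempty_ball.2 hr) measure_ball_lt_top.ne measurableSet_ball
    (convex_ball _ _) measure_ball_lt_top.ne (hL2 P hP) (hL2 Q hQ)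
  refine ⟨R, v, Metric.isOpen_ball.reProdIm Metric.isOpen_ball,
    convex_reProdIm (convex_ball _ _) (convex_ball _ _), hR.trans hrΩ,
    ⟨Metric.mem_ball_self hr, Metric.mem_ball_self hr⟩, hloc v hv, hloc P (hL2 P hP),
    hloc Q (hL2 Q hQ), fun φ hφ => ?_, fun φ hφ => ?_⟩
  · simpa only [smul_eq_mul, mul_comm] using (hvPQ φ hφ).1
  · simpa only [smul_eq_mul, mul_comm] using (hvPQ φ hφ).2

theorem IsWeaklyCurlFree.exists_hasWeakGrad {P Q : ℂ → ℝ} (h : IsWeaklyCurlFree Ω P Q)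
    (hΩ : IsOpen Ω) (hsc : IsSimplyConnected Ω) (hP : MemL2loc Ω P) (hQ : MemL2loc Ω Q) :
    ∃ v, HasWeakGrad Ω v P Q := by
  choose U v hU hUc hUΩ hzU hv using fun z : Ω => h.exists_hasWeakGrad_of_mem hΩ hP hQ z.2
  exact HasWeakGrad.exists_of_cover hΩ hsc hU hUc hUΩ (fun z hz => ⟨⟨z, hz⟩, hzU _⟩) hv

end WeakPoincare

section Divergence

variable {Ω : Set ℂ} {V W : ℂ → ℂ} {φ : ℂ → ℝ}

theorem IsWeaklyCurlFree.congr_ae {P Q P' Q' : ℂ → ℝ} (h : IsWeaklyCurlFree Ω P Q)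
    (hP : P =ᵐ[volume.restrict Ω] P') (hQ : Q =ᵐ[volume.restrict Ω] Q') :
    IsWeaklyCurlFree Ω P' Q' := fun φ hφ =>
  calc ∫ z in Ω, P' z * fderiv ℝ φ z I
    _ = ∫ z in Ω, P z * fderiv ℝ φ z I :=
        integral_congr_ae (hP.mono fun z hz => by simp only [hz])
    _ = ∫ z in Ω, Q z * fderiv ℝ φ z 1 := h φ hφ
    _ = ∫ z in Ω, Q' z * fderiv ℝ φ z 1 :=
        integral_congr_ae (hQ.mono fun z hz => by simp only [hz])

theorem IsTestFun.integrable_re_mul_fderiv_apply (hφ : IsTestFun Ω φ) (e : ℂ)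
    (hV : LocallyIntegrableOn V Ω) : Integrable fun z => (V z).re * fderiv ℝ φ z e := by
  simpa [mul_comm] using ((hφ.fderiv_apply e).integrable_smul hV).re

theorem IsTestFun.integrable_im_mul_fderiv_apply (hφ : IsTestFun Ω φ) (e : ℂ)
    (hV : LocallyIntegrableOn V Ω) : Integrable fun z => (V z).im * fderiv ℝ φ z e := by
  simpa [mul_comm] using ((hφ.fderiv_apply e).integrable_smul hV).im

theorem IsTestFun.integrable_fderiv_clm_apply (hφ : IsTestFun Ω φ)
    (hV : LocallyIntegrableOn V Ω) : Integrable fun z => fderiv ℝ φ z (V z) :=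
  ((hφ.integrable_re_mul_fderiv_apply 1 hV).add (hφ.integrable_im_mul_fderiv_apply I hV)).congr
    (.of_forall fun z => (clm_apply_eq_re_smul_add_im_smul _ (V z)).symm)

theorem IsTestFun.setIntegral_fderiv_clm_apply (hφ : IsTestFun Ω φ)
    (hV : LocallyIntegrableOn V Ω) : ∫ z in Ω, fderiv ℝ φ z (V z) =
      (∫ z in Ω, (V z).re * fderiv ℝ φ z 1) + ∫ z in Ω, (V z).im * fderiv ℝ φ z I := by
  rw [← integral_add (hφ.integrable_re_mul_fderiv_apply 1 hV).integrableOn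
    (hφ.integrable_im_mul_fderiv_apply I hV).integrableOn]
  exact integral_congr_ae (.of_forall fun z => clm_apply_eq_re_smul_add_im_smul _ (V z))

theorem divEq_iff_isWeaklyCurlFree (hV : LocallyIntegrableOn V Ω) (hW : LocallyIntegrableOn W Ω) :
    DivEq Ω V W ↔ IsWeaklyCurlFree Ω (fun z => -(V z - W z).im) fun z => (V z - W z).re := by
  have hiff : ∀ φ, IsTestFun Ω φ →
      (∫ z in Ω, fderiv ℝ φ z (V z) = ∫ z in Ω, fderiv ℝ φ z (W z) ↔
        ∫ z in Ω, -(V z - W z).im * fderiv ℝ φ z I =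
          ∫ z in Ω, (V z - W z).re * fderiv ℝ φ z 1) := fun φ hφ => by
    have hsub := hφ.setIntegral_fderiv_clm_apply (hV.sub hW)
    simp only [Pi.sub_apply, map_sub] at hsub
    rw [integral_sub (hφ.integrable_fderiv_clm_apply hV).integrableOn
      (hφ.integrable_fderiv_clm_apply hW).integrableOn] at hsub
    simp only [neg_mul, integral_neg]
    constructor <;> intro h <;> linarith
  exact ⟨fun h φ hφ => (hiff φ hφ).1 (h.weak φ hφ),
    fun h => ⟨hV, hW, fun φ hφ => (hiff φ hφ).2 (h φ hφ)⟩⟩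

end Divergence

section StrongMonotonicity

variable {E : Type*} [NormedAddCommGroup E] [InnerProductSpace ℝ E] {K : ℝ} {a b : E}

theorem norm_sq_add_norm_sq_le_inner_iff_norm_sub_le_norm_add (hK : 1 ≤ K) :
    ‖a‖ ^ 2 + ‖b‖ ^ 2 ≤ (K + 1 / K) * inner ℝ a b ↔
      ‖a - b‖ ≤ (K - 1) / (K + 1) * ‖a + b‖ := by
  have hK0 : 0 < K := by linarith
  have hk0 : 0 ≤ (K - 1) / (K + 1) := div_nonneg (sub_nonneg.2 hK) (by positivity)
  rw [← sq_le_sq₀ (norm_nonneg _) (mul_nonneg hk0 (norm_nonneg _)), mul_pow,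
    norm_sub_sq_real, norm_add_sq_real, div_pow, div_mul_eq_mul_div, le_div_iff₀ (by positivity),
    ← mul_le_mul_iff_right₀ hK0, ← mul_assoc, mul_add K K, mul_one_div_cancel hK0.ne']
  constructor <;> intro h <;> nlinarith

theorem norm_sub_smul_le_of_norm_sq_add_norm_sq_le_inner (hK : 1 ≤ K)
    (h : ‖a‖ ^ 2 + ‖b‖ ^ 2 ≤ (K + 1 / K) * inner ℝ a b) :
    ‖b - ((K + 1 / K) / 2) • a‖ ≤ (K - 1 / K) / 2 * ‖a‖ := by
  have hK1 : 1 / K ≤ K := ((div_le_one (by linarith)).2 hK).trans hK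
  refine le_of_sq_le_sq ?_ (mul_nonneg (by linarith) (norm_nonneg _))
  have hsq : ((K + 1 / K) / 2) ^ 2 = ((K - 1 / K) / 2) ^ 2 + 1 := by
    field_simp
    ring
  rw [norm_sub_sq_real, inner_smul_right, norm_smul, real_inner_comm, mul_pow, mul_pow,
    Real.norm_eq_abs, sq_abs, hsq]
  linarith

end StrongMonotonicity

theorem eq_div_one_sub_iff_eq_sub_one_div {k K : ℝ} (hk : k < 1) (hK : 1 ≤ K) :
    K = (1 + k) / (1 - k) ↔ k = (K - 1) / (K + 1) := by
  rw [eq_div_iff (sub_pos.2 hk).ne', eq_div_iff (by positivity)]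
  constructor <;> intro h <;> linarith

section Caratheodory

variable {X Y Z : Type*} [MeasurableSpace X] {μ : Measure X} [MeasurableSpace Z] {H : X → Y → Z}

theorem aemeasurable_apply_simpleFunc (hH : ∀ y, AEMeasurable (fun x => H x y) μ)
    (s : SimpleFunc X Y) : AEMeasurable (fun x => H x (s x)) μ := by
  have hcover : ⋃ y : s.range, s ⁻¹' {y.1} = Set.univ :=
    Set.iUnion_eq_univ_iff.2 fun x => ⟨⟨s x, s.mem_range_self x⟩, rfl⟩
  rw [← μ.restrict_univ, ← hcover, aemeasurable_iUnion_iff]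
  refine fun y => (hH y).restrict.congr ?_
  filter_upwards [ae_restrict_mem (s.measurableSet_fiber y)] with x hx
  rw [show s x = y from hx]

theorem aemeasurable_apply_of_continuous [TopologicalSpace Y] [TopologicalSpace Z]
    [TopologicalSpace.PseudoMetrizableSpace Z] [BorelSpace Z]
    (hH : ∀ y, AEMeasurable (fun x => H x y) μ) (hc : ∀ᵐ x ∂μ, Continuous (H x)) {w : X → Y}
    (hw : AEStronglyMeasurable w μ) : AEMeasurable (fun x => H x (w x)) μ := by
  have hmk := hw.stronglyMeasurable_mk
  refine aemeasurable_of_tendsto_metrizable_ae Filter.atTop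
    (fun n => aemeasurable_apply_simpleFunc hH (hmk.approx n)) ?_
  filter_upwards [hc, hw.ae_eq_mk] with x hx hwx
  rw [hwx]
  exact (hx.tendsto _).comp (hmk.tendsto_approx x)

end Caratheodory

namespace IsLipschitzField

variable {Ω : Set ℂ} {k r : ℝ} {H N : ℂ → ℂ → ℂ} {w : ℂ → ℂ}

theorem lipschitzWith (h : IsLipschitzField Ω k H) {z : ℂ} (hz : z ∈ Ω) :
    LipschitzWith k.toNNReal (H z) :=
  .of_dist_le' fun ζ η => by simpa only [dist_eq_norm] using h.lipschitz z hz ζ η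

theorem aemeasurable_apply (h : IsLipschitzField Ω k H) (hΩ : MeasurableSet Ω)
    (hw : AEMeasurable w (volume.restrict Ω)) :
    AEMeasurable (fun z => H z (w z)) (volume.restrict Ω) := by
  refine aemeasurable_apply_of_continuous h.measurable ?_ hw.aestronglyMeasurable
  filter_upwards [ae_restrict_mem hΩ] with z hz using (h.lipschitzWith hz).continuous

theorem translate (h : IsLipschitzField Ω k H) (hΩ : MeasurableSet Ω)
    (hw : AEMeasurable w (volume.restrict Ω)) :
    IsLipschitzField Ω k fun z ζ => H z (ζ + w z) - H z (w z) where
  measurable ζ := (h.aemeasurable_apply hΩ (hw.const_add ζ)).sub (h.aemeasurable_apply hΩ hw)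
  lipschitz z hz ζ η := by simpa using h.lipschitz z hz (ζ + w z) (η + w z)

theorem comp_conj (h : IsLipschitzField Ω k H) :
    IsLipschitzField Ω k fun z ζ => H z (conj ζ) where
  measurable ζ := h.measurable (conj ζ)
  lipschitz z hz ζ η := by
    simpa only [← map_sub, RCLike.norm_conj] using h.lipschitz z hz (conj ζ) (conj η)

theorem memL2loc_apply (h : IsLipschitzField Ω k H) (hΩ : IsOpen Ω) (h0 : ∀ z ∈ Ω, H z 0 = 0)
    (hw : MemL2loc Ω w) : MemL2loc Ω fun z => H z (w z) := by
  intro C hC hCΩ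
  have hm := ((h.aemeasurable_apply hΩ.measurableSet
    (hw.locallyIntegrableOn hΩ).aestronglyMeasurable.aemeasurable).mono_set hCΩ)
  refine (hw C hC hCΩ).of_le_mul (c := k) hm.aestronglyMeasurable ?_
  filter_upwards [ae_restrict_mem hC.measurableSet] with z hz
  simpa [h0 z (hCΩ hz)] using h.lipschitz z (hCΩ hz) (w z) 0

theorem exists_aemeasurable_fixedPoint (h : IsLipschitzField Ω k H) (hΩ : MeasurableSet Ω)
    (hk : k < 1) : ∃ p, AEMeasurable p (volume.restrict Ω) ∧ ∀ z ∈ Ω, H z (p z) = p z := by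
  have hbanach : ∀ z ∈ Ω, ∃ p, H z p = p ∧
      Filter.Tendsto (fun n => (H z)^[n] 0) Filter.atTop (nhds p) := fun z hz =>
    have hcontr : ContractingWith k.toNNReal (H z) :=
      ⟨Real.toNNReal_lt_one.2 hk, h.lipschitzWith hz⟩
    let ⟨p, hp, hlim, _⟩ := hcontr.exists_fixedPoint 0 (edist_ne_top _ _)
    ⟨p, hp, hlim⟩
  choose! p hfix hlim using hbanach
  have hiter : ∀ n : ℕ, AEMeasurable (fun z => (H z)^[n] 0) (volume.restrict Ω) := fun n => by
    induction n with
    | zero => exact aemeasurable_const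
    | succ n ih =>
      simp only [Function.iterate_succ_apply']
      exact h.aemeasurable_apply hΩ ih
  refine ⟨p, aemeasurable_of_tendsto_metrizable_ae Filter.atTop hiter ?_, hfix⟩
  filter_upwards [ae_restrict_mem hΩ] with z hz using hlim z hz

theorem exists_aemeasurable_inverse (h : IsLipschitzField Ω k N) (hΩ : MeasurableSet Ω)
    (hr : 0 < r) (hk : k < r) : ∃ X : ℂ → ℂ → ℂ,
      (∀ ζ, AEMeasurable (fun z => X z ζ) (volume.restrict Ω)) ∧
      (∀ z ∈ Ω, ∀ ζ, r • X z ζ + N z (X z ζ) = ζ) ∧ ∀ z ∈ Ω, ∀ ξ, X z (r • ξ + N z ξ) = ξ := by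
  have hT : ∀ ζ : ℂ, IsLipschitzField Ω (r⁻¹ * k) fun z ξ => r⁻¹ • (ζ - N z ξ) := fun ζ =>
    { measurable := fun ξ => ((h.measurable ξ).const_sub ζ).const_smul r⁻¹
      lipschitz := fun z hz ξ η => by
        rw [← smul_sub, sub_sub_sub_cancel_left, norm_smul, Real.norm_of_nonneg (by positivity),
          norm_sub_rev, mul_assoc]
        gcongr
        exact h.lipschitz z hz ξ η }
  choose X hXm hX using fun ζ =>
    (hT ζ).exists_aemeasurable_fixedPoint hΩ ((inv_mul_lt_one₀ hr).2 hk)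
  have hright : ∀ z ∈ Ω, ∀ ζ, r • X ζ z + N z (X ζ z) = ζ := fun z hz ζ => by
    have hfix := hX ζ z hz
    rw [inv_smul_eq_iff₀ hr.ne'] at hfix
    rw [← hfix, sub_add_cancel]
  have hinj : ∀ z ∈ Ω, ∀ ξ η, r • ξ + N z ξ = r • η + N z η → ξ = η := fun z hz ξ η hξη => by
    have hN : N z ξ - N z η = -(r • (ξ - η)) := by
      rw [smul_sub]
      linear_combination hξη
    have hle := h.lipschitz z hz ξ η
    rw [hN, norm_neg, norm_smul, Real.norm_of_nonneg hr.le] at hle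
    by_contra hne
    exact (mul_lt_mul_of_pos_right hk (norm_pos_iff.2 (sub_ne_zero.2 hne))).not_ge hle
  exact ⟨fun z ζ => X ζ z, hXm, hright, fun z hz ξ => hinj z hz _ _ (hright z hz _)⟩

end IsLipschitzField

namespace IsStronglyElliptic

variable {Ω : Set ℂ} {K : ℝ} {A : ℂ → ℂ → ℂ}

theorem isLipschitzField_sub_smul (h : IsStronglyElliptic Ω K A) (hK : 1 ≤ K) :
    IsLipschitzField Ω ((K - 1 / K) / 2) fun z ξ => A z ξ - ((K + 1 / K) / 2) • ξ where
  measurable ξ := (h.measurable ξ).sub_const _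
  lipschitz z hz ξ η := by
    rw [sub_sub_sub_comm, ← smul_sub]
    exact norm_sub_smul_le_of_norm_sq_add_norm_sq_le_inner hK (h.elliptic z hz ξ η)

theorem isLipschitzField (h : IsStronglyElliptic Ω K A) (hK : 1 ≤ K) :
    IsLipschitzField Ω K A where
  measurable := h.measurable
  lipschitz z hz ξ η := by
    have hsub := (h.isLipschitzField_sub_smul hK).lipschitz z hz ξ η
    rw [sub_sub_sub_comm, ← smul_sub] at hsub
    calc ‖A z ξ - A z η‖
        ≤ (K - 1 / K) / 2 * ‖ξ - η‖ + ‖((K + 1 / K) / 2) • (ξ - η)‖ :=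
          (norm_le_norm_sub_add _ _).trans (by gcongr)
      _ = K * ‖ξ - η‖ := by
          rw [norm_smul, Real.norm_of_nonneg (by positivity)]
          ring

theorem translate (h : IsStronglyElliptic Ω K A) (hK : 1 ≤ K) (hΩ : MeasurableSet Ω) {w : ℂ → ℂ}
    (hw : AEMeasurable w (volume.restrict Ω)) :
    IsStronglyElliptic Ω K fun z ξ => A z (ξ + w z) - A z (w z) where
  measurable := ((h.isLipschitzField hK).translate hΩ hw).measurable
  elliptic z hz ξ₁ ξ₂ := by simpa using h.elliptic z hz (ξ₁ + w z) (ξ₂ + w z)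
  map_zero z _ := by simp

end IsStronglyElliptic

theorem IsLipschitzField.exists_isStronglyElliptic {Ω : Set ℂ} {k : ℝ} {N : ℂ → ℂ → ℂ}
    (h : IsLipschitzField Ω k N) (hΩ : MeasurableSet Ω) (hk0 : 0 ≤ k) (hk1 : k < 1)
    (h0 : ∀ z ∈ Ω, N z 0 = 0) : ∃ A, IsStronglyElliptic Ω ((1 + k) / (1 - k)) A ∧
      ∀ z ∈ Ω, ∀ q, A z (q + N z q) = q - N z q := by
  obtain ⟨X, hXm, hX, hXN⟩ := h.exists_aemeasurable_inverse hΩ one_pos hk1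
  simp only [one_smul] at hX hXN
  have hK : 1 ≤ (1 + k) / (1 - k) := (one_le_div (by linarith)).2 (by linarith)
  refine ⟨fun z ξ => X z ξ + X z ξ - ξ,
    ⟨fun ξ => ((hXm ξ).add (hXm ξ)).sub_const ξ, fun z hz ξ₁ ξ₂ => ?_, fun z hz => ?_⟩,
    fun z hz q => ?_⟩
  · rw [norm_sq_add_norm_sq_le_inner_iff_norm_sub_le_norm_add hK,
      ← (eq_div_one_sub_iff_eq_sub_one_div hk1 hK).1 rfl]
    have hsub : ξ₁ - ξ₂ - (X z ξ₁ + X z ξ₁ - ξ₁ - (X z ξ₂ + X z ξ₂ - ξ₂)) =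
        2 * (N z (X z ξ₁) - N z (X z ξ₂)) := by
      linear_combination -2 * hX z hz ξ₁ + 2 * hX z hz ξ₂
    have hadd : ξ₁ - ξ₂ + (X z ξ₁ + X z ξ₁ - ξ₁ - (X z ξ₂ + X z ξ₂ - ξ₂)) =
        2 * (X z ξ₁ - X z ξ₂) := by ring
    rw [hsub, hadd, norm_mul, norm_mul, mul_left_comm]
    gcongr
    exact h.lipschitz z hz _ _
  · simpa [h0 z hz] using hXN z hz 0
  · simp only [hXN z hz]
    ring

theorem IsStronglyElliptic.exists_isLipschitzField {Ω : Set ℂ} {K : ℝ} {A : ℂ → ℂ → ℂ}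
    (h : IsStronglyElliptic Ω K A) (hΩ : MeasurableSet Ω) (hK : 1 ≤ K) :
    ∃ N, IsLipschitzField Ω ((K - 1) / (K + 1)) N ∧
      ∀ z ∈ Ω, ∀ ξ, N z ((ξ + A z ξ) / 2) = (ξ - A z ξ) / 2 := by
  obtain ⟨X, hXm, hX, hXA⟩ := (h.isLipschitzField_sub_smul hK).exists_aemeasurable_inverse hΩ
    (r := 1 + (K + 1 / K) / 2) (by positivity) (by linarith [show 0 ≤ 1 / K by positivity])
  have hcancel : ∀ z ξ, (1 + (K + 1 / K) / 2) • ξ + (A z ξ - ((K + 1 / K) / 2) • ξ) = ξ + A z ξ :=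
    fun z ξ => by
      rw [add_smul, one_smul]
      ring
  simp only [hcancel] at hX hXA
  refine ⟨fun z q => X z (2 * q) - q, ⟨fun q => (hXm _).sub_const q, fun z hz q₁ q₂ => ?_⟩,
    fun z hz ξ => ?_⟩
  · have hell := (norm_sq_add_norm_sq_le_inner_iff_norm_sub_le_norm_add hK).1
      (h.elliptic z hz (X z (2 * q₁)) (X z (2 * q₂)))
    have hsub : X z (2 * q₁) - X z (2 * q₂) - (A z (X z (2 * q₁)) - A z (X z (2 * q₂))) =
        2 * (X z (2 * q₁) - q₁ - (X z (2 * q₂) - q₂)) := by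
      linear_combination -hX z hz (2 * q₁) + hX z hz (2 * q₂)
    have hadd : X z (2 * q₁) - X z (2 * q₂) + (A z (X z (2 * q₁)) - A z (X z (2 * q₂))) =
        2 * (q₁ - q₂) := by
      linear_combination hX z hz (2 * q₁) - hX z hz (2 * q₂)
    rw [hsub, hadd, norm_mul, norm_mul, mul_left_comm] at hell
    exact le_of_mul_le_mul_left hell (by simp)
  · simp only [mul_div_cancel₀ _ (two_ne_zero (α := ℂ)), hXA z hz]
    ring

section WirtingerDerivatives

variable {Ω : Set ℂ} {f fx fy g : ℂ → ℂ}

theorem conj_dz_add_dzbar (a b : ℂ) :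
    conj ((a - I * b) / 2) + (a + I * b) / 2 = (a.re : ℂ) + I * (b.re : ℂ) := by
  rw [map_div₀, Complex.conj_ofNat, ← add_div, div_eq_iff two_ne_zero]
  apply Complex.ext <;> simp <;> ring

theorem conj_dz_sub_dzbar (a b : ℂ) :
    conj ((a - I * b) / 2) - (a + I * b) / 2 = (b.im : ℂ) - I * (a.im : ℂ) := by
  rw [map_div₀, Complex.conj_ofNat, ← sub_div, div_eq_iff two_ne_zero]
  apply Complex.ext <;> simp <;> ring

theorem HasWeakGrad.memL2loc_dz (h : HasWeakGrad Ω f fx fy) :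
    MemL2loc Ω fun z => (fx z - I * fy z) / 2 :=
  (h.memL2loc_x.sub (h.memL2loc_y.const_mul I)).div_const 2

theorem HasWeakGrad.memL2loc_dzbar (h : HasWeakGrad Ω f fx fy) :
    MemL2loc Ω fun z => (fx z + I * fy z) / 2 :=
  (h.memL2loc_x.add (h.memL2loc_y.const_mul I)).div_const 2

theorem HasWeakGrad.memL2loc_gradient {u ux uy : ℂ → ℝ} (h : HasWeakGrad Ω u ux uy) :
    MemL2loc Ω fun z => (ux z : ℂ) + I * (uy z : ℂ) :=
  (h.memL2loc_x.clm_comp ofRealCLM).add ((h.memL2loc_y.clm_comp ofRealCLM).const_mul I)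

theorem HasWeakGrad.add_I_mul {u ux uy v vx vy : ℂ → ℝ} (hΩ : IsOpen Ω)
    (hu : HasWeakGrad Ω u ux uy) (hv : HasWeakGrad Ω v vx vy) :
    HasWeakGrad Ω (fun z => (u z : ℂ) + I * (v z : ℂ)) (fun z => (ux z : ℂ) + I * (vx z : ℂ))
      fun z => (uy z : ℂ) + I * (vy z : ℂ) :=
  (hu.clm_comp hΩ ofRealCLM).add hΩ (hv.clm_comp hΩ (I • ofRealCLM))

end WirtingerDerivatives

section Equivalence

variable {Ω : Set ℂ} {k K : ℝ} {H A : ℂ → ℂ → ℂ} {f fx fy g G : ℂ → ℂ}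

theorem HasWeakGrad.solvesLerayLions_re (hΩ : IsOpen Ω) (hf : HasWeakGrad Ω f fx fy)
    (hg : MemL2loc Ω g)
    (h : ∀ᵐ z ∂volume.restrict Ω, A z (((fx z).re : ℂ) + I * ((fy z).re : ℂ)) - g z =
      ((fy z).im : ℂ) - I * ((fx z).im : ℂ)) :
    SolvesLerayLions Ω A g fun z => (f z).re := by
  have him : HasWeakGrad Ω _ _ _ := hf.clm_comp hΩ imCLM
  refine ⟨_, _, hf.clm_comp hΩ reCLM, (divEq_iff_isWeaklyCurlFree ?_ ?_).2 ?_⟩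
  · have hrot : MemL2loc Ω fun z => ((fy z).im : ℂ) - I * ((fx z).im : ℂ) :=
      (him.memL2loc_y.clm_comp ofRealCLM).sub ((him.memL2loc_x.clm_comp ofRealCLM).const_mul I)
    refine ((hg.add hrot).congr_ae ?_).locallyIntegrableOn hΩ
    filter_upwards [h] with z hz using by rw [← hz]; exact add_sub_cancel _ _
  · exact hg.locallyIntegrableOn hΩ
  · refine him.isWeaklyCurlFree.congr_ae ?_ ?_ <;> filter_upwards [h] with z hz <;>
      simp only [reCLM_apply, imCLM_apply, hz] <;> simp

theorem SolvesBeltrami.memL2loc (h : SolvesBeltrami Ω H G f) (hΩ : IsOpen Ω)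
    (hH : IsLipschitzField Ω k H) : MemL2loc Ω fun z => G z + H z 0 := by
  obtain ⟨fx, fy, hf, heq⟩ := h
  have hH₀ := (hH.translate hΩ.measurableSet (w := 0) aemeasurable_const).memL2loc_apply hΩ
    (fun z _ => by simp) hf.memL2loc_dz
  refine (hf.memL2loc_dzbar.sub hH₀).congr_ae ?_
  filter_upwards [heq] with z hz
  simp only [hz, Pi.zero_apply, add_zero]
  ring

theorem IsLipschitzField.exists_solvesLerayLions_of_memL2loc (hΩ : IsOpen Ω) (hk0 : 0 ≤ k)
    (hk1 : k < 1) (hH : IsLipschitzField Ω k H) (hG : MemL2loc Ω fun z => G z + H z 0) :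
    ∃ A g, IsStronglyElliptic Ω ((1 + k) / (1 - k)) A ∧ MemL2loc Ω g ∧
      ∀ f, SolvesBeltrami Ω H G f → SolvesLerayLions Ω A g fun z => (f z).re := by
  have hΩm := hΩ.measurableSet
  have hK : 1 ≤ (1 + k) / (1 - k) := (one_le_div (by linarith)).2 (by linarith)
  obtain ⟨A, hA, hAN⟩ := (hH.translate hΩm (w := 0) aemeasurable_const).comp_conj
    |>.exists_isStronglyElliptic hΩm hk0 hk1 (fun z _ => by simp)
  simp only [Pi.zero_apply, add_zero] at hAN
  set G₀ : ℂ → ℂ := fun z => G z + H z 0 with hG₀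
  have hAG := (hA.isLipschitzField hK).memL2loc_apply hΩ hA.map_zero hG.neg
  refine ⟨_, fun z => G₀ z - A z (-G₀ z),
    hA.translate hK hΩm (hG.neg.locallyIntegrableOn hΩ).aestronglyMeasurable.aemeasurable,
    hG.sub hAG, ?_⟩
  rintro f ⟨fx, fy, hf, heq⟩
  refine hf.solvesLerayLions_re hΩ (hG.sub hAG) ?_
  filter_upwards [heq, ae_restrict_mem hΩm] with z hz hzΩ
  have hcayley := hAN z hzΩ (conj ((fx z - I * fy z) / 2))
  rw [conj_conj] at hcayley
  have hgrad : ((fx z).re : ℂ) + I * ((fy z).re : ℂ) + -G₀ z =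
      conj ((fx z - I * fy z) / 2) + (H z ((fx z - I * fy z) / 2) - H z 0) := by
    rw [← conj_dz_add_dzbar, hz, hG₀]
    ring
  rw [hgrad, hcayley, ← conj_dz_sub_dzbar, hz, hG₀]
  ring

theorem IsLipschitzField.exists_solvesLerayLions (hΩ : IsOpen Ω) (hk0 : 0 ≤ k) (hk1 : k < 1)
    (hH : IsLipschitzField Ω k H) (G : ℂ → ℂ) :
    ∃ A g, IsStronglyElliptic Ω ((1 + k) / (1 - k)) A ∧ MemL2loc Ω g ∧
      ∀ f, SolvesBeltrami Ω H G f → SolvesLerayLions Ω A g fun z => (f z).re := by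
  by_cases hG : MemL2loc Ω fun z => G z + H z 0
  · exact hH.exists_solvesLerayLions_of_memL2loc hΩ hk0 hk1 hG
  · have hzero : IsLipschitzField Ω k fun _ _ => 0 :=
      ⟨fun _ => aemeasurable_const, fun _ _ _ _ => by simpa using by positivity⟩
    obtain ⟨A, hA, -⟩ := hzero.exists_isStronglyElliptic hΩ.measurableSet hk0 hk1 fun _ _ => rfl
    exact ⟨A, 0, hA, .const Ω 0, fun f hf => absurd (hf.memL2loc hΩ hH) hG⟩

theorem DivEq.exists_hasWeakGrad {V : ℂ → ℂ} (h : DivEq Ω V g) (hΩ : IsOpen Ω)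
    (hsc : IsSimplyConnected Ω) (hV : MemL2loc Ω V) (hg : MemL2loc Ω g) :
    ∃ v, HasWeakGrad Ω v (fun z => -(V z - g z).im) fun z => (V z - g z).re :=
  ((divEq_iff_isWeaklyCurlFree h.locInt_left h.locInt_right).1 h).exists_hasWeakGrad hΩ hsc
    ((hV.sub hg).clm_comp (-imCLM)) ((hV.sub hg).clm_comp reCLM)

theorem IsStronglyElliptic.exists_solvesBeltrami (hΩ : IsOpen Ω) (hsc : IsSimplyConnected Ω)
    (hK : 1 ≤ K) (hA : IsStronglyElliptic Ω K A) (hg : MemL2loc Ω g) :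
    ∃ H G, IsLipschitzField Ω ((K - 1) / (K + 1)) H ∧ (∀ z ∈ Ω, H z 0 = 0) ∧ MemL2loc Ω G ∧
      ∀ u, SolvesLerayLions Ω A g u →
        ∃ v : ℂ → ℝ, MemW12loc Ω v ∧ SolvesBeltrami Ω H G fun z => (u z : ℂ) + I * (v z : ℂ) := by
  have hΩm := hΩ.measurableSet
  obtain ⟨N, hN, hNA⟩ := hA.exists_isLipschitzField hΩm hK
  have hN0 : ∀ z ∈ Ω, N z 0 = 0 := fun z hz => by simpa [hA.map_zero z hz] using hNA z hz 0
  have hg2 := hg.div_const 2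
  refine ⟨_, fun z => N z (g z / 2) + g z / 2, (hN.translate hΩm
    (hg2.locallyIntegrableOn hΩ).aestronglyMeasurable.aemeasurable).comp_conj,
    fun z _ => by simp, (hN.memL2loc_apply hΩ hN0 hg2).add hg2, ?_⟩
  rintro u ⟨ux, uy, hu, hdiv⟩
  obtain ⟨v, hv⟩ := hdiv.exists_hasWeakGrad hΩ hsc
    ((hA.isLipschitzField hK).memL2loc_apply hΩ hA.map_zero hu.memL2loc_gradient) hg
  refine ⟨v, ⟨_, _, hv⟩, _, _, hu.add_I_mul hΩ hv, ?_⟩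
  filter_upwards [ae_restrict_mem hΩm] with z hz
  set ξ : ℂ := (ux z : ℂ) + I * (uy z : ℂ)
  set fx : ℂ := (ux z : ℂ) + I * ((-(A z ξ - g z).im : ℝ) : ℂ)
  set fy : ℂ := (uy z : ℂ) + I * (((A z ξ - g z).re : ℝ) : ℂ)
  have hadd : conj ((fx - I * fy) / 2) + (fx + I * fy) / 2 = ξ := by
    rw [conj_dz_add_dzbar]
    simp [fx, fy, ξ]
  have hsub : conj ((fx - I * fy) / 2) - (fx + I * fy) / 2 = A z ξ - g z := by
    rw [conj_dz_sub_dzbar]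
    apply Complex.ext <;> simp [fx, fy]
  have harg : conj ((fx - I * fy) / 2) + g z / 2 = (ξ + A z ξ) / 2 := by
    linear_combination (hadd + hsub) / 2
  rw [harg, hNA z hz]
  linear_combination (hadd - hsub) / 2

end Equivalence

theorem mainTheorem7 (Ω : Set ℂ) (hΩ : IsOpen Ω) (hsc : IsSimplyConnected Ω) :
    (∀ k : ℝ, 0 ≤ k → k < 1 → ∀ (H : ℂ → ℂ → ℂ) (G : ℂ → ℂ), IsLipschitzField Ω k H →
      ∃ (A : ℂ → ℂ → ℂ) (g : ℂ → ℂ),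
        IsStronglyElliptic Ω ((1 + k) / (1 - k)) A ∧ MemL2loc Ω g ∧
        ∀ f : ℂ → ℂ, SolvesBeltrami Ω H G f →
          SolvesLerayLions Ω A g (fun z => (f z).re)) ∧
    (∀ K : ℝ, 1 ≤ K → ∀ (A : ℂ → ℂ → ℂ) (g : ℂ → ℂ), IsStronglyElliptic Ω K A → MemL2loc Ω g →
      ∃ (H : ℂ → ℂ → ℂ) (G : ℂ → ℂ),
        IsLipschitzField Ω ((K - 1) / (K + 1)) H ∧ (∀ z ∈ Ω, H z 0 = 0) ∧ MemL2loc Ω G ∧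
        ∀ u : ℂ → ℝ, SolvesLerayLions Ω A g u →
          ∃ v : ℂ → ℝ, MemW12loc Ω v ∧
            SolvesBeltrami Ω H G (fun z => (u z : ℂ) + I * (v z : ℂ))) ∧
    (∀ k K : ℝ, 0 ≤ k → k < 1 → 1 ≤ K →
      (K = (1 + k) / (1 - k) ↔ k = (K - 1) / (K + 1))) := by
  exact ⟨fun k hk0 hk1 H G hH => hH.exists_solvesLerayLions hΩ hk0 hk1 G,
    fun K hK A g hA hg => hA.exists_solvesBeltrami hΩ hsc hK hg,
    fun k K _ hk1 hK => eq_div_one_sub_iff_eq_sub_one_div hk1 hK⟩
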